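/- Let $0<p<1$ and let $F$ be a finite simple graph with $k=v(F)$ vertices and at least one edge. For $n\ge k$ let $\xi_{i,j}$, $1\le i<j\le n$, be the edge indicators of the Erdős–Rényi random graph $G(n,p)$ (i.i.d. Bernoulli($p$) random variables; $\xi_{j,i}=\xi_{i,j}$), and let $$T_F^{\mathrm{inj}}=\sum_{1\le \alpha(1)<\dots<\alpha(k)\le n}\ \ \sum_{H\cong F}\ \prod_{\{i,j\}\in E(H)}\xi_{\alpha(i),\alpha(j)},$$ where the inner sum ranges over all graphs $H$ on the vertex set $\{1,\dots,k\}$ that are isomorphic to $F$. Then there is a constant $C>0$, depending only on $F$ and $p$, such that for all $n\ge k$ one has $\operatorname{Var}(T_F^{\mathrm{inj}})>0$ and $$\sup_{z\in\mathbb R}\left|\mathbb P\!\left[\frac{T_F^{\mathrm{inj}}-\mathbb E\,T_F^{\mathrm{inj}}}{\bigl(\operatorname{Var}T_F^{\mathrm{inj}}\bigr)^{1/2}}\le z\right]-\Phi(z)\right|\le C\,n^{-1},$$ where $\Phi$ is the distribution function of the standard normal law $N(0,1)$. -/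

import Mathlib

open MeasureTheory ProbabilityTheory

noncomputable section

open scoped Classical in
/-- The kernel `φ_F^inj`. Its argument `x` assigns a real number to each unordered pair of elements
of `Fin k`, and the sum ranges over all graphs `H` with vertex set `Fin k` (that is, over all
spanning subgraphs of the complete graph on `k` vertices) that are isomorphic to `F`. -/
def injKernel {V : Type*} (F : SimpleGraph V) (k : ℕ) (x : Sym2 (Fin k) → ℝ) : ℝ :=
  ∑ H : SimpleGraph (Fin k) with Nonempty (H ≃g F), ∏ e ∈ H.edgeFinset, x e

open scoped Classical in
/-- The edge indicator `ξ` of a graph `G`: it is `1` on the edges of `G` and `0` elsewhere. -/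
def edgeIndicator {W : Type*} (G : SimpleGraph W) (e : Sym2 W) : ℝ :=
  if e ∈ G.edgeSet then 1 else 0

/-- The injective subgraph count `T_F^inj` of a graph `G` on `n` vertices: the sum, over all
`α(1) < ⋯ < α(k)` in `Fin n`, where `k` is the number of vertices of `F`, of `φ_F^inj` evaluated
at the edge indicators `ξ_{α(i), α(j)}`. -/
def injCount {V : Type*} [Fintype V] (F : SimpleGraph V) {n : ℕ} (G : SimpleGraph (Fin n)) : ℝ :=
  ∑ α : Fin (Fintype.card V) ↪o Fin n,
    injKernel F (Fintype.card V) (fun e => edgeIndicator G (e.map α))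

end

/-! The proof combines Stein's method with discrete Malliavin calculus on the cube of edge
indicators ξ_e. Let q = p(1-p), let U be the set of potential edges, W the standardised count and
D_e the operator `discDeriv e`. Expanding W in products of centred indicators and dividing each
product of degree d by d gives Ψ with W = Σ_e (ξ_e - p) D_eΨ. Integration by parts then yields E[W
G] = q Σ_e E[D_eΨ D_eG] for every G. Take G = f(W), where f solves Stein's equation for a half line.
If D_e f(W) is replaced by D_eW f'(W), what remains is to compare Γ = q Σ_e D_eΨ D_eW with its mean
1, and `bernoulliExp_poincare` bounds the variance of Γ through second derivatives.

The replacement is the delicate point, since f' has a jump. By `abs_steinSol_sub_sub_le` the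
remainder is at most D_eW · D_e h(W) with h bounded and monotone. Weighted by |D_eΨ| and summed,
these bounds can be integrated by parts backwards: they equal E[Z h(W)] with Z = Σ_e (ξ_e - p)
|D_eΨ| D_eW, and the second moment of Z is controlled like the variance of Γ. Both errors are O(√|U|
A²), where A bounds the first derivatives of W and Ψ and the row sums of the second ones
(`abs_bernoulliExp_sub_cdf_le`).

For copies of F, an edge lies in O(n^(k-2)) of them, so the derivatives before standardising have
that order. Cauchy–Schwarz against the number of edges shows that the variance is at least of order
n^(2k-2) (`le_card_mul_bernoulliVar_subsetCount`). Hence A = O(1/n), and √|U| ≤ n leaves the rate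
1/n. -/

/-! ### Functionals of independent Bernoulli variables -/

section Cube

set_option linter.unusedSectionVars false

variable {E : Type*} [DecidableEq E]

/-- The expectation of `X S`, where `S` is a random subset of `U` that contains each element
independently with probability `p`. -/
noncomputable def bernoulliExp (p : ℝ) (U : Finset E) (X : Finset E → ℝ) : ℝ :=
  ∑ S ∈ U.powerset, p ^ S.card * (1 - p) ^ (U.card - S.card) * X S

/-- The discrete derivative of `X` in direction `e`. -/
def discDeriv (e : E) (X : Finset E → ℝ) (S : Finset E) : ℝ :=
  X (insert e S) - X (S.erase e)

/-- The centred indicator of `e ∈ S`. -/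
noncomputable def centredInd (p : ℝ) (e : E) (S : Finset E) : ℝ :=
  (if e ∈ S then 1 else 0) - p

/-! ### Expectations on the cube and integration by parts -/

section Expectation

variable {p : ℝ} {U : Finset E} {X Y : Finset E → ℝ}

lemma bernoulliExp_congr (h : ∀ S ⊆ U, X S = Y S) : bernoulliExp p U X = bernoulliExp p U Y :=
  Finset.sum_congr rfl fun S hS => by rw [h S (Finset.mem_powerset.1 hS)]

lemma bernoulliExp_mono (hp0 : 0 ≤ p) (hp1 : p ≤ 1) (h : ∀ S ⊆ U, X S ≤ Y S) :
    bernoulliExp p U X ≤ bernoulliExp p U Y :=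
  Finset.sum_le_sum fun S hS => mul_le_mul_of_nonneg_left (h S (Finset.mem_powerset.1 hS))
    (mul_nonneg (pow_nonneg hp0 _) (pow_nonneg (sub_nonneg.2 hp1) _))

lemma bernoulliExp_add :
    bernoulliExp p U (fun S => X S + Y S) = bernoulliExp p U X + bernoulliExp p U Y := by
  simp [bernoulliExp, mul_add, Finset.sum_add_distrib]

lemma bernoulliExp_sub :
    bernoulliExp p U (fun S => X S - Y S) = bernoulliExp p U X - bernoulliExp p U Y := by
  simp [bernoulliExp, mul_sub, Finset.sum_sub_distrib]

lemma bernoulliExp_const_mul (c : ℝ) :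
    bernoulliExp p U (fun S => c * X S) = c * bernoulliExp p U X := by
  simp only [bernoulliExp, Finset.mul_sum]
  exact Finset.sum_congr rfl fun S _ => by ring

lemma bernoulliExp_sum {ι : Type*} (s : Finset ι) (X : ι → Finset E → ℝ) :
    bernoulliExp p U (fun S => ∑ i ∈ s, X i S) = ∑ i ∈ s, bernoulliExp p U (X i) := by
  simp only [bernoulliExp, Finset.mul_sum]
  exact Finset.sum_comm

lemma bernoulliExp_insert {a : E} (ha : a ∉ U) :
    bernoulliExp p (insert a U) X =
      (1 - p) * bernoulliExp p U X + p * bernoulliExp p U (fun S => X (insert a S)) := by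
  simp only [bernoulliExp]
  rw [Finset.sum_powerset_insert ha, Finset.mul_sum, Finset.mul_sum, Finset.card_insert_of_notMem ha]
  congr 1
  · refine Finset.sum_congr rfl fun S hS => ?_
    have := Finset.card_le_card (Finset.mem_powerset.1 hS)
    rw [show U.card + 1 - S.card = (U.card - S.card) + 1 by omega]
    ring
  · refine Finset.sum_congr rfl fun S hS => ?_
    rw [Finset.card_insert_of_notMem fun h => ha (Finset.mem_powerset.1 hS h),
      Nat.add_sub_add_right]
    ring

lemma bernoulliExp_const (c : ℝ) : bernoulliExp p U (fun _ => c) = c := by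
  induction U using Finset.induction_on with
  | empty => simp [bernoulliExp]
  | insert a U ha ih => rw [bernoulliExp_insert ha, ih]; ring

lemma abs_bernoulliExp_le (hp0 : 0 ≤ p) (hp1 : p ≤ 1) :
    |bernoulliExp p U X| ≤ bernoulliExp p U (fun S => |X S|) := by
  refine (Finset.abs_sum_le_sum_abs _ _).trans_eq (Finset.sum_congr rfl fun S _ => ?_)
  rw [abs_mul, abs_of_nonneg (mul_nonneg (pow_nonneg hp0 _) (pow_nonneg (sub_nonneg.2 hp1) _))]

lemma bernoulliExp_mul_sq_le (hp0 : 0 ≤ p) (hp1 : p ≤ 1) :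
    bernoulliExp p U (fun S => X S * Y S) ^ 2 ≤
      bernoulliExp p U (fun S => X S ^ 2) * bernoulliExp p U (fun S => Y S ^ 2) := by
  refine Finset.sum_sq_le_sum_mul_sum_of_sq_le_mul _ (fun S _ => ?_) (fun S _ => ?_)
    fun S _ => le_of_eq ?_
  · exact mul_nonneg (mul_nonneg (pow_nonneg hp0 _) (pow_nonneg (sub_nonneg.2 hp1) _))
      (sq_nonneg _)
  · exact mul_nonneg (mul_nonneg (pow_nonneg hp0 _) (pow_nonneg (sub_nonneg.2 hp1) _))
      (sq_nonneg _)
  · ring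

lemma bernoulliExp_sq_le (hp0 : 0 ≤ p) (hp1 : p ≤ 1) :
    bernoulliExp p U X ^ 2 ≤ bernoulliExp p U (fun S => X S ^ 2) := by
  simpa [bernoulliExp_const] using bernoulliExp_mul_sq_le (X := X) (Y := fun _ => 1) (U := U) hp0 hp1

lemma bernoulliExp_abs_le_sqrt (hp0 : 0 ≤ p) (hp1 : p ≤ 1) :
    bernoulliExp p U (fun S => |X S|) ≤ √(bernoulliExp p U (fun S => X S ^ 2)) := by
  refine Real.le_sqrt_of_sq_le ?_
  simpa using bernoulliExp_sq_le (X := fun S => |X S|) (U := U) hp0 hp1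

/-- Averaging over the state of a single element does not change the expectation. -/
lemma bernoulliExp_average {e : E} (he : e ∈ U) :
    bernoulliExp p U X =
      bernoulliExp p U (fun S => p * X (insert e S) + (1 - p) * X (S.erase e)) := by
  obtain ⟨V, heV, rfl⟩ : ∃ V, e ∉ V ∧ U = insert e V :=
    ⟨U.erase e, Finset.notMem_erase _ _, (Finset.insert_erase he).symm⟩
  have h1 : bernoulliExp p V (fun S => p * X (insert e S) + (1 - p) * X (S.erase e)) =
      bernoulliExp p V (fun S => p * X (insert e S) + (1 - p) * X S) :=
    bernoulliExp_congr fun S hS => by rw [Finset.erase_eq_of_notMem fun h => heV (hS h)]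
  have h2 : bernoulliExp p V (fun S => p * X (insert e (insert e S)) +
      (1 - p) * X ((insert e S).erase e)) =
      bernoulliExp p V (fun S => p * X (insert e S) + (1 - p) * X S) :=
    bernoulliExp_congr fun S hS => by
      rw [Finset.erase_insert fun h => heV (hS h), Finset.insert_idem]
  rw [bernoulliExp_insert heV, bernoulliExp_insert heV, h1, h2, bernoulliExp_add,
    bernoulliExp_const_mul, bernoulliExp_const_mul]
  ring

/-- Integration by parts. -/
lemma bernoulliExp_centredInd_mul {e : E} (he : e ∈ U) :
    bernoulliExp p U (fun S => centredInd p e S * X S) =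
      p * (1 - p) * bernoulliExp p U (discDeriv e X) := by
  rw [bernoulliExp_average he, ← bernoulliExp_const_mul]
  congr 1
  ext S
  simp [centredInd, discDeriv]
  ring

end Expectation

/-! ### Calculus of discrete derivatives -/

section Derivative

variable {e f : E} {X Y : Finset E → ℝ}

lemma discDeriv_insert (e : E) (X : Finset E → ℝ) (S : Finset E) :
    discDeriv e X (insert e S) = discDeriv e X S := by
  simp [discDeriv]

lemma discDeriv_erase (e : E) (X : Finset E → ℝ) (S : Finset E) :
    discDeriv e X (S.erase e) = discDeriv e X S := by
  have : insert e (S.erase e) = insert e S := by ext; simp; tauto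
  simp [discDeriv, this]

lemma discDeriv_comm (e f : E) (X : Finset E → ℝ) (S : Finset E) :
    discDeriv e (discDeriv f X) S = discDeriv f (discDeriv e X) S := by
  rcases eq_or_ne e f with rfl | h
  · rfl
  · simp only [discDeriv]
    rw [Finset.insert_comm, Finset.erase_right_comm, Finset.erase_insert_of_ne h.symm,
      Finset.erase_insert_of_ne h]
    ring

lemma discDeriv_eq_zero (h : ∀ S, X (insert e S) = X (S.erase e)) (S : Finset E) :
    discDeriv e X S = 0 := sub_eq_zero.2 (h S)

lemma discDeriv_mul (e : E) (X Y : Finset E → ℝ) (S : Finset E) :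
    discDeriv e (fun S => X S * Y S) S =
      discDeriv e X S * Y (insert e S) + X (S.erase e) * discDeriv e Y S := by
  simp only [discDeriv]; ring

lemma discDeriv_sum {ι : Type*} (s : Finset ι) (X : ι → Finset E → ℝ) (S : Finset E) :
    discDeriv e (fun S => ∑ i ∈ s, X i S) S = ∑ i ∈ s, discDeriv e (X i) S := by
  simp [discDeriv, Finset.sum_sub_distrib]

lemma discDeriv_const_mul (c : ℝ) (S : Finset E) :
    discDeriv e (fun S => c * X S) S = c * discDeriv e X S := by
  simp only [discDeriv]; ring

lemma abs_discDeriv_abs_le (S : Finset E) :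
    |discDeriv e (fun S => |X S|) S| ≤ |discDeriv e X S| :=
  abs_abs_sub_abs_le_abs_sub _ _

lemma abs_discDeriv_mul_le {A B : ℝ} (hX : ∀ S, |X S| ≤ A) (hY : ∀ S, |Y S| ≤ B) (S : Finset E) :
    |discDeriv e (fun S => X S * Y S) S| ≤ |discDeriv e X S| * B + A * |discDeriv e Y S| := by
  rw [discDeriv_mul]
  refine (abs_add_le _ _).trans ?_
  rw [abs_mul, abs_mul]
  gcongr
  · exact hY _
  · exact hX _

lemma discDeriv_centredInd_self (p : ℝ) (S : Finset E) :
    discDeriv e (centredInd p e) S = 1 := by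
  simp [discDeriv, centredInd]

lemma centredInd_insert_of_ne (p : ℝ) (h : f ≠ e) (S : Finset E) :
    centredInd p f (insert e S) = centredInd p f S := by
  simp [centredInd, h]

lemma centredInd_erase_of_ne (p : ℝ) (h : f ≠ e) (S : Finset E) :
    centredInd p f (S.erase e) = centredInd p f S := by
  simp [centredInd, h]

lemma abs_centredInd_le {p : ℝ} (hp0 : 0 ≤ p) (hp1 : p ≤ 1) (S : Finset E) :
    |centredInd p e S| ≤ 1 := by
  unfold centredInd
  split_ifs <;> rw [abs_le] <;> constructor <;> linarith

end Derivative

/-- The Efron–Stein (Poincaré) inequality on the cube. -/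
theorem bernoulliExp_poincare {p : ℝ} (hp0 : 0 ≤ p) (hp1 : p ≤ 1) (U : Finset E)
    (X : Finset E → ℝ) :
    bernoulliExp p U (fun S => X S ^ 2) - bernoulliExp p U X ^ 2 ≤
      p * (1 - p) * ∑ e ∈ U, bernoulliExp p U (fun S => discDeriv e X S ^ 2) := by
  induction U using Finset.induction_on generalizing X with
  | empty => simp [bernoulliExp]
  | insert a U ha ih =>
    -- Condition on the state of `a`: the variance is the average of the two conditional variances
    -- (`h0`, `h1`) plus p(1-p) times the squared difference of the conditional means, which Jensen
    -- (`hsq`) bounds by the `a`-term of the sum.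
    have h0 := ih X
    have h1 := ih (fun S => X (insert a S))
    have hsq := bernoulliExp_sq_le (p := p) (U := U) (X := fun S => X (insert a S) - X S) hp0 hp1
    rw [bernoulliExp_sub] at hsq
    have hda : bernoulliExp p (insert a U) (fun S => discDeriv a X S ^ 2) =
        bernoulliExp p U (fun S => (X (insert a S) - X S) ^ 2) := by
      rw [bernoulliExp_insert ha]
      simp only [discDeriv_insert]
      rw [← add_mul, sub_add_cancel, one_mul]
      exact bernoulliExp_congr fun S hS => by
        rw [discDeriv, Finset.erase_eq_of_notMem fun h => ha (hS h)]
    have hde : ∑ e ∈ U, bernoulliExp p (insert a U) (fun S => discDeriv e X S ^ 2) =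
        (1 - p) * ∑ e ∈ U, bernoulliExp p U (fun S => discDeriv e X S ^ 2) +
        p * ∑ e ∈ U, bernoulliExp p U
          (fun S => discDeriv e (fun S => X (insert a S)) S ^ 2) := by
      rw [Finset.mul_sum, Finset.mul_sum, ← Finset.sum_add_distrib]
      refine Finset.sum_congr rfl fun e he => ?_
      have hne : a ≠ e := fun h => ha (h ▸ he)
      rw [bernoulliExp_insert ha]
      congr 2
      refine bernoulliExp_congr fun S _ => ?_
      rw [discDeriv, discDeriv, Finset.insert_comm, Finset.erase_insert_of_ne hne]
    rw [Finset.sum_insert ha, hda, hde, bernoulliExp_insert ha, bernoulliExp_insert ha]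
    have hp1' : 0 ≤ 1 - p := sub_nonneg.2 hp1
    have e0 := mul_le_mul_of_nonneg_left h0 hp1'
    have e1 := mul_le_mul_of_nonneg_left h1 hp0
    have e2 := mul_le_mul_of_nonneg_left hsq (mul_nonneg hp0 hp1')
    linarith

end Cube

/-! ### Stein's equation for the standard normal law -/

section Stein

open Set Filter Topology

/-- The unnormalised standard Gaussian distribution function. -/
noncomputable def gaussTail (w : ℝ) : ℝ := ∫ x in Iic w, Real.exp (-(1 / 2) * x ^ 2)

/-- The ratio of the (unnormalised) standard Gaussian distribution function and density. -/
noncomputable def millsRatio (w : ℝ) : ℝ := Real.exp (w ^ 2 / 2) * gaussTail w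

lemma integrable_gaussWeight : Integrable fun x : ℝ => Real.exp (-(1 / 2) * x ^ 2) :=
  integrable_exp_neg_mul_sq (by norm_num)

lemma integrable_mul_gaussWeight : Integrable fun x : ℝ => x * Real.exp (-(1 / 2) * x ^ 2) :=
  integrable_mul_exp_neg_mul_sq (by norm_num)

lemma integrable_sq_mul_gaussWeight :
    Integrable fun x : ℝ => x ^ 2 * Real.exp (-(1 / 2) * x ^ 2) := by
  simpa using integrable_rpow_mul_exp_neg_mul_sq (b := 1 / 2) (by norm_num)
    (by norm_num : (-1 : ℝ) < 2)

lemma hasDerivAt_gaussWeight (x : ℝ) :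
    HasDerivAt (fun x : ℝ => Real.exp (-(1 / 2) * x ^ 2)) (-(x * Real.exp (-(1 / 2) * x ^ 2))) x := by
  have h := ((hasDerivAt_pow 2 x).const_mul (-(1 / 2) : ℝ)).exp
  refine h.congr_deriv ?_
  push_cast
  ring

lemma hasDerivAt_mul_gaussWeight (x : ℝ) :
    HasDerivAt (fun x : ℝ => x * Real.exp (-(1 / 2) * x ^ 2))
      (Real.exp (-(1 / 2) * x ^ 2) - x ^ 2 * Real.exp (-(1 / 2) * x ^ 2)) x := by
  refine ((hasDerivAt_id x).mul (hasDerivAt_gaussWeight x)).congr_deriv ?_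
  simp
  ring

lemma setIntegral_mul_gaussWeight (w : ℝ) :
    ∫ x in Iic w, x * Real.exp (-(1 / 2) * x ^ 2) = -Real.exp (-(1 / 2) * w ^ 2) := by
  have hlim := tendsto_zero_of_hasDerivAt_of_integrableOn_Iic (a := w)
    (fun x _ => hasDerivAt_gaussWeight x) integrable_mul_gaussWeight.neg.integrableOn
    integrable_gaussWeight.integrableOn
  have h := integral_Iic_of_hasDerivAt_of_tendsto
    (hasDerivAt_gaussWeight w).continuousAt.continuousWithinAt
    (fun x _ => hasDerivAt_gaussWeight x) integrable_mul_gaussWeight.neg.integrableOn hlim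
  rw [integral_neg] at h
  linarith

lemma setIntegral_sq_mul_gaussWeight (w : ℝ) :
    ∫ x in Iic w, x ^ 2 * Real.exp (-(1 / 2) * x ^ 2) =
      gaussTail w - w * Real.exp (-(1 / 2) * w ^ 2) := by
  have hint := (integrable_gaussWeight.sub integrable_sq_mul_gaussWeight).integrableOn (s := Iic w)
  have hlim := tendsto_zero_of_hasDerivAt_of_integrableOn_Iic (a := w)
    (fun x _ => hasDerivAt_mul_gaussWeight x) hint integrable_mul_gaussWeight.integrableOn
  have h := integral_Iic_of_hasDerivAt_of_tendsto
    (hasDerivAt_mul_gaussWeight w).continuousAt.continuousWithinAt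
    (fun x _ => hasDerivAt_mul_gaussWeight x) hint hlim
  rw [integral_sub integrable_gaussWeight.integrableOn
    integrable_sq_mul_gaussWeight.integrableOn] at h
  rw [gaussTail]
  linarith

/-- The expression is the integral of the nonnegative w - x against the Gaussian weight over x ≤ w.
-/
lemma mul_gaussTail_add_nonneg (w : ℝ) :
    0 ≤ w * gaussTail w + Real.exp (-(1 / 2) * w ^ 2) := by
  have h : ∫ x in Iic w, (w - x) * Real.exp (-(1 / 2) * x ^ 2) =
      w * gaussTail w + Real.exp (-(1 / 2) * w ^ 2) := by
    simp only [sub_mul]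
    rw [integral_sub (integrable_gaussWeight.const_mul w).integrableOn
      integrable_mul_gaussWeight.integrableOn, integral_const_mul, setIntegral_mul_gaussWeight,
      gaussTail]
    ring
  rw [← h]
  exact setIntegral_nonneg measurableSet_Iic fun x hx =>
    mul_nonneg (sub_nonneg.2 hx) (Real.exp_pos _).le

/-- Same device with (w - x)². Up to the factor exp(w²/2), this is the derivative of w ·
`millsRatio` w. -/
lemma sq_mul_gaussTail_add_nonneg (w : ℝ) :
    0 ≤ (1 + w ^ 2) * gaussTail w + w * Real.exp (-(1 / 2) * w ^ 2) := by
  have h : ∫ x in Iic w, (w - x) ^ 2 * Real.exp (-(1 / 2) * x ^ 2) =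
      (1 + w ^ 2) * gaussTail w + w * Real.exp (-(1 / 2) * w ^ 2) := by
    have : ∀ x : ℝ, (w - x) ^ 2 * Real.exp (-(1 / 2) * x ^ 2) =
        (w ^ 2 * Real.exp (-(1 / 2) * x ^ 2) - 2 * w * (x * Real.exp (-(1 / 2) * x ^ 2))) +
          x ^ 2 * Real.exp (-(1 / 2) * x ^ 2) := fun x => by ring
    simp only [this]
    have hi : Integrable fun x : ℝ => w ^ 2 * Real.exp (-(1 / 2) * x ^ 2) -
        2 * w * (x * Real.exp (-(1 / 2) * x ^ 2)) :=
      (integrable_gaussWeight.const_mul _).sub (integrable_mul_gaussWeight.const_mul _)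
    rw [integral_add hi.integrableOn integrable_sq_mul_gaussWeight.integrableOn,
      integral_sub (integrable_gaussWeight.const_mul _).integrableOn
        (integrable_mul_gaussWeight.const_mul _).integrableOn, integral_const_mul,
      integral_const_mul, setIntegral_mul_gaussWeight, setIntegral_sq_mul_gaussWeight, ← gaussTail]
    ring
  rw [← h]
  exact setIntegral_nonneg measurableSet_Iic fun x _ =>
    mul_nonneg (sq_nonneg _) (Real.exp_pos _).le

lemma hasDerivAt_gaussTail (w : ℝ) :
    HasDerivAt gaussTail (Real.exp (-(1 / 2) * w ^ 2)) w := by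
  have hc : Continuous fun x : ℝ => Real.exp (-(1 / 2) * x ^ 2) := by fun_prop
  have h := (intervalIntegral.integral_hasDerivAt_right (hc.intervalIntegrable 0 w)
    hc.stronglyMeasurable.stronglyMeasurableAtFilter hc.continuousAt).const_add (gaussTail 0)
  refine h.congr_of_eventuallyEq (Eventually.of_forall fun x => ?_)
  have := intervalIntegral.integral_Iic_sub_Iic (μ := volume) (a := 0) (b := x)
    integrable_gaussWeight.integrableOn integrable_gaussWeight.integrableOn
  simp only [gaussTail]
  linarith

lemma exp_half_mul_gaussWeight (w : ℝ) :
    Real.exp (w ^ 2 / 2) * Real.exp (-(1 / 2) * w ^ 2) = 1 := by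
  rw [← Real.exp_add, show w ^ 2 / 2 + -(1 / 2) * w ^ 2 = 0 by ring, Real.exp_zero]

lemma hasDerivAt_millsRatio (w : ℝ) : HasDerivAt millsRatio (w * millsRatio w + 1) w := by
  have h1 : HasDerivAt (fun w : ℝ => Real.exp (w ^ 2 / 2)) (Real.exp (w ^ 2 / 2) * w) w := by
    refine ((hasDerivAt_pow 2 w).div_const 2).exp.congr_deriv ?_
    push_cast
    ring
  refine (h1.mul (hasDerivAt_gaussTail w)).congr_deriv ?_
  rw [exp_half_mul_gaussWeight, millsRatio]
  ring

lemma neg_one_le_mul_millsRatio (w : ℝ) : -1 ≤ w * millsRatio w := by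
  have h := mul_nonneg (Real.exp_pos (w ^ 2 / 2)).le (mul_gaussTail_add_nonneg w)
  rw [mul_add, exp_half_mul_gaussWeight] at h
  rw [millsRatio]
  linarith

lemma monotone_mul_millsRatio : Monotone fun w => w * millsRatio w := by
  have hd : ∀ w, HasDerivAt (fun w => w * millsRatio w)
      (1 * millsRatio w + w * (w * millsRatio w + 1)) w :=
    fun w => (hasDerivAt_id w).mul (hasDerivAt_millsRatio w)
  refine monotone_of_deriv_nonneg (fun w => (hd w).differentiableAt) fun w => ?_
  rw [(hd w).deriv]
  have h := mul_nonneg (Real.exp_pos (w ^ 2 / 2)).le (sq_mul_gaussTail_add_nonneg w)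
  have e := exp_half_mul_gaussWeight w
  have : Real.exp (w ^ 2 / 2) * ((1 + w ^ 2) * gaussTail w + w * Real.exp (-(1 / 2) * w ^ 2)) =
      1 * millsRatio w + w * (w * millsRatio w + 1) := by
    rw [millsRatio]
    linear_combination w * e
  rwa [← this]

lemma gaussTail_add_gaussTail_neg (z : ℝ) :
    gaussTail z + gaussTail (-z) = √(2 * Real.pi) := by
  have h1 := integral_comp_neg_Iic (-z) fun x : ℝ => Real.exp (-(1 / 2) * x ^ 2)
  simp only [neg_sq, neg_neg] at h1
  have h2 := intervalIntegral.integral_Iic_add_Ioi (μ := volume) (b := z)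
    integrable_gaussWeight.integrableOn integrable_gaussWeight.integrableOn
  have h3 := integral_gaussian (1 / 2)
  rw [gaussTail, gaussTail, h1, h2, h3]
  congr 1
  ring

lemma cdf_gaussianReal_eq (z : ℝ) :
    cdf (gaussianReal 0 1) z = (√(2 * Real.pi))⁻¹ * gaussTail z := by
  rw [cdf_eq_real, measureReal_def, gaussianReal_apply_eq_integral 0 one_ne_zero,
    ENNReal.toReal_ofReal (integral_nonneg fun x => gaussianPDFReal_nonneg _ _ _), gaussTail,
    ← integral_const_mul]
  congr 1
  ext x
  simp only [gaussianPDFReal_def, sub_zero, NNReal.coe_one, mul_one]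
  congr 2
  ring

/-- The bounded solution of Stein's equation for the half line `Iic z`. -/
noncomputable def steinSol (z w : ℝ) : ℝ :=
  if w ≤ z then (1 - cdf (gaussianReal 0 1) z) * millsRatio w
  else cdf (gaussianReal 0 1) z * millsRatio (-w)

/-- The derivative of `steinSol`, as prescribed by Stein's equation. -/
noncomputable def steinDeriv (z w : ℝ) : ℝ :=
  w * steinSol z w + ((if w ≤ z then 1 else 0) - cdf (gaussianReal 0 1) z)

lemma steinSol_of_le {z w : ℝ} (h : w ≤ z) :
    steinSol z w = (1 - cdf (gaussianReal 0 1) z) * millsRatio w := if_pos h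

/-- At w = z the two branches agree, because the two Gaussian tails add up to √(2π). -/
lemma steinSol_of_ge {z w : ℝ} (h : z ≤ w) :
    steinSol z w = cdf (gaussianReal 0 1) z * millsRatio (-w) := by
  rcases h.eq_or_lt with rfl | h
  · rw [steinSol_of_le le_rfl]
    have hs := gaussTail_add_gaussTail_neg z
    have hpos : 0 < √(2 * Real.pi) := Real.sqrt_pos.2 (by positivity)
    have : 1 - cdf (gaussianReal 0 1) z = (√(2 * Real.pi))⁻¹ * gaussTail (-z) := by
      rw [cdf_gaussianReal_eq, ← inv_mul_cancel₀ hpos.ne', ← mul_sub]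
      congr 1
      linarith
    rw [this, cdf_gaussianReal_eq, millsRatio, millsRatio, neg_sq]
    ring
  · exact if_neg h.not_ge

lemma hasDerivAt_millsRatio_neg (w : ℝ) :
    HasDerivAt (fun w => millsRatio (-w)) (w * millsRatio (-w) - 1) w := by
  refine ((hasDerivAt_millsRatio (-w)).comp w (hasDerivAt_neg w)).congr_deriv ?_
  ring

/-- `steinSol z` has a kink at z. Its right derivative there belongs to the upper branch, hence the
strict inequality, in contrast to `steinDeriv`. -/
lemma hasDerivWithinAt_steinSol (z w : ℝ) :
    HasDerivWithinAt (steinSol z)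
      (w * steinSol z w + ((if w < z then 1 else 0) - cdf (gaussianReal 0 1) z)) (Ici w) w := by
  rcases lt_or_ge w z with h | h
  · have hd := (hasDerivAt_millsRatio w).const_mul (1 - cdf (gaussianReal 0 1) z)
    rw [if_pos h, steinSol_of_le h.le]
    refine (HasDerivAt.congr_of_eventuallyEq (f := fun w =>
      (1 - cdf (gaussianReal 0 1) z) * millsRatio w) ?_ ?_).hasDerivWithinAt
    · exact hd.congr_deriv (by ring)
    · filter_upwards [Iio_mem_nhds h] with x hx using steinSol_of_le (le_of_lt hx)
  · have hd := (hasDerivAt_millsRatio_neg w).const_mul (cdf (gaussianReal 0 1) z)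
    rw [if_neg h.not_gt, steinSol_of_ge h]
    refine (hd.congr_deriv ?_).hasDerivWithinAt.congr (fun x hx => steinSol_of_ge (h.trans hx))
      (steinSol_of_ge h)
    ring

lemma continuous_steinSol (z : ℝ) : Continuous (steinSol z) := by
  have h1 : Continuous millsRatio :=
    continuous_iff_continuousAt.2 fun w => (hasDerivAt_millsRatio w).continuousAt
  unfold steinSol
  refine Continuous.if_le (by fun_prop) (by fun_prop) continuous_id continuous_const ?_
  rintro x rfl
  rw [← steinSol_of_le le_rfl, ← steinSol_of_ge le_rfl]

lemma monotone_mul_steinSol (z : ℝ) : Monotone fun w => w * steinSol z w := by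
  have h0 := cdf_nonneg (gaussianReal 0 1) z
  have h1 := cdf_le_one (gaussianReal 0 1) z
  refine MonotoneOn.Iic_union_Ici (a := z) (fun x hx y hy hxy => ?_) fun x hx y hy hxy => ?_
  · have := mul_le_mul_of_nonneg_left (monotone_mul_millsRatio hxy) (sub_nonneg.2 h1)
    simp only [steinSol_of_le (mem_Iic.1 hx), steinSol_of_le (mem_Iic.1 hy)]
    simp only at this
    linarith
  · have := mul_le_mul_of_nonneg_left (monotone_mul_millsRatio (neg_le_neg hxy)) h0
    simp only [steinSol_of_ge (mem_Ici.1 hx), steinSol_of_ge (mem_Ici.1 hy)]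
    simp only at this
    linarith

/-- The Mills ratio bound gives the lower estimate left of z and the upper one right of z;
monotonicity carries each across z. -/
lemma abs_mul_steinSol_le (z w : ℝ) : |w * steinSol z w| ≤ 1 := by
  have h0 := cdf_nonneg (gaussianReal 0 1) z
  have h1 := cdf_le_one (gaussianReal 0 1) z
  have hl : ∀ w ≤ z, -1 ≤ w * steinSol z w := fun w hw => by
    rw [steinSol_of_le hw]
    nlinarith [neg_one_le_mul_millsRatio w]
  have hu : ∀ w, z ≤ w → w * steinSol z w ≤ 1 := fun w hw => by
    rw [steinSol_of_ge hw]
    nlinarith [neg_one_le_mul_millsRatio (-w)]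
  rw [abs_le]
  rcases le_total w z with h | h
  · exact ⟨hl w h, (monotone_mul_steinSol z h).trans (hu z le_rfl)⟩
  · exact ⟨(hl z le_rfl).trans (monotone_mul_steinSol z h), hu w h⟩

lemma abs_steinDeriv_le (z w : ℝ) : |steinDeriv z w| ≤ 2 := by
  have h0 := cdf_nonneg (gaussianReal 0 1) z
  have h1 := cdf_le_one (gaussianReal 0 1) z
  have h2 := abs_le.1 (abs_mul_steinSol_le z w)
  rw [steinDeriv, abs_le]
  split_ifs <;> constructor <;> linarith [h2.1, h2.2]

/-- The monotone function that controls the increments of `steinDeriv`. -/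
noncomputable def steinMono (z w : ℝ) : ℝ := w * steinSol z w - if w ≤ z then 1 else 0

lemma abs_steinMono_le (z w : ℝ) : |steinMono z w| ≤ 2 := by
  have h2 := abs_le.1 (abs_mul_steinSol_le z w)
  rw [steinMono, abs_le]
  split_ifs <;> constructor <;> linarith [h2.1, h2.2]

/-- The slope is the increasing w · `steinSol z w` plus a decreasing indicator, minus a constant.
Evaluating the two parts at opposite endpoints bounds the slope on the whole interval, and the mean
value inequality for right derivatives passes over the kink. -/
lemma steinSol_increment_bounds (z : ℝ) {u w : ℝ} (h : u ≤ w) :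
    steinSol z w - steinSol z u ≤ (w - u) *
        (w * steinSol z w + ((if u ≤ z then 1 else 0) - cdf (gaussianReal 0 1) z)) ∧
      (w - u) * (u * steinSol z u + ((if w ≤ z then 1 else 0) - cdf (gaussianReal 0 1) z)) ≤
        steinSol z w - steinSol z u := by
  have hlin : ∀ c x : ℝ, HasDerivWithinAt (fun x => steinSol z u + (x - u) * c) c (Ici x) x :=
    fun c x => by
      have := (((hasDerivAt_id x).sub_const u).mul_const c).const_add (steinSol z u)
      exact (this.congr_deriv (by simp)).hasDerivWithinAt
  have hcont : ∀ c : ℝ, ContinuousOn (fun x => steinSol z u + (x - u) * c) (Icc u w) :=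
    fun c => by fun_prop
  have hs : ContinuousOn (steinSol z) (Icc u w) := (continuous_steinSol z).continuousOn
  have hfwd : ∀ c : ℝ, (∀ x ∈ Ico u w, x * steinSol z x +
      ((if x < z then 1 else 0) - cdf (gaussianReal 0 1) z) ≤ c) →
      steinSol z w - steinSol z u ≤ (w - u) * c := fun c hc =>
    sub_le_iff_le_add'.2 (image_le_of_deriv_right_le_deriv_boundary hs
      (fun x _ => hasDerivWithinAt_steinSol z x) (by simp) (hcont c) (fun x _ => hlin c x) hc
      (right_mem_Icc.2 h))
  have hbwd : ∀ c : ℝ, (∀ x ∈ Ico u w, c ≤ x * steinSol z x +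
      ((if x < z then 1 else 0) - cdf (gaussianReal 0 1) z)) →
      (w - u) * c ≤ steinSol z w - steinSol z u := fun c hc =>
    le_sub_iff_add_le'.2 (image_le_of_deriv_right_le_deriv_boundary (hcont c)
      (fun x _ => hlin c x) (by simp) hs (fun x _ => hasDerivWithinAt_steinSol z x) hc
      (right_mem_Icc.2 h))
  constructor
  · refine hfwd _ fun x hx => add_le_add (monotone_mul_steinSol z hx.2.le) ?_
    have hux := hx.1
    split_ifs <;> linarith
  · refine hbwd _ fun x hx => add_le_add (monotone_mul_steinSol z hx.1) ?_
    have hux := hx.2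
    split_ifs <;> linarith

/-- A first order expansion of the solution of Stein's equation whose error term is an increment
of a bounded function. -/
lemma abs_steinSol_sub_sub_le (z w w' : ℝ) :
    |steinSol z w - steinSol z w' - (w - w') * steinDeriv z w| ≤
      (w - w') * (steinMono z w - steinMono z w') := by
  simp only [steinDeriv, steinMono]
  rcases le_total w' w with h | h
  · obtain ⟨h1, h2⟩ := steinSol_increment_bounds z h
    have hm := mul_nonneg (sub_nonneg.2 h) (sub_nonneg.2 (monotone_mul_steinSol z h))
    have hi : 0 ≤ (w - w') * ((if w' ≤ z then (1 : ℝ) else 0) - if w ≤ z then 1 else 0) := by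
      refine mul_nonneg (sub_nonneg.2 h) ?_
      split_ifs <;> linarith
    simp only at hm
    rw [abs_le]
    constructor <;> nlinarith
  · obtain ⟨h1, h2⟩ := steinSol_increment_bounds z h
    have hm := mul_nonneg (sub_nonneg.2 h) (sub_nonneg.2 (monotone_mul_steinSol z h))
    have hi : 0 ≤ (w' - w) * ((if w ≤ z then (1 : ℝ) else 0) - if w' ≤ z then 1 else 0) := by
      refine mul_nonneg (sub_nonneg.2 h) ?_
      split_ifs <;> linarith
    simp only at hm
    rw [abs_le]
    constructor <;> nlinarith

end Stein

/-! ### A Berry–Esseen bound for functionals of independent Bernoulli variables -/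

section BerryEsseen

variable {E : Type*} [DecidableEq E] {p : ℝ} {U : Finset E}

/-- Integration by parts for a sum of centred indicators with predictable weights. -/
lemma bernoulliExp_sum_centredInd_mul {g : E → Finset E → ℝ}
    (hins : ∀ e S, g e (insert e S) = g e S) (her : ∀ e S, g e (S.erase e) = g e S)
    (G : Finset E → ℝ) :
    bernoulliExp p U (fun S => (∑ e ∈ U, centredInd p e S * g e S) * G S) =
      p * (1 - p) * ∑ e ∈ U, bernoulliExp p U (fun S => g e S * discDeriv e G S) := by
  simp only [Finset.sum_mul, mul_assoc (centredInd p _ _)]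
  rw [bernoulliExp_sum, Finset.mul_sum]
  refine Finset.sum_congr rfl fun e he => ?_
  rw [bernoulliExp_centredInd_mul he]
  congr 2
  ext S
  rw [discDeriv, hins, her, discDeriv, mul_sub]

/-- This serves both the terms of Γ and the weights |D_eΨ| D_eW of Z. -/
lemma sum_abs_discDeriv_mul_le {A : ℝ} {f : E} {X Y : E → Finset E → ℝ}
    (hX : ∀ e ∈ U, ∀ S, |X e S| ≤ A) (hY : ∀ e ∈ U, ∀ S, |Y e S| ≤ A)
    (hX' : ∀ S, ∑ e ∈ U, |discDeriv f (X e) S| ≤ A)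
    (hY' : ∀ S, ∑ e ∈ U, |discDeriv f (Y e) S| ≤ A) (S : Finset E) :
    ∑ e ∈ U, |discDeriv f (fun S => X e S * Y e S) S| ≤ 2 * A ^ 2 := by
  have hA : 0 ≤ A := (Finset.sum_nonneg fun e _ => abs_nonneg _).trans (hX' S)
  calc ∑ e ∈ U, |discDeriv f (fun S => X e S * Y e S) S|
      ≤ ∑ e ∈ U, (|discDeriv f (X e) S| * A + A * |discDeriv f (Y e) S|) :=
        Finset.sum_le_sum fun e he => abs_discDeriv_mul_le (hX e he) (hY e he) S
    _ = (∑ e ∈ U, |discDeriv f (X e) S|) * A + A * ∑ e ∈ U, |discDeriv f (Y e) S| := by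
        rw [Finset.sum_add_distrib, Finset.sum_mul, Finset.mul_sum]
    _ ≤ A * A + A * A := by
        gcongr
        · exact hX' S
        · exact hY' S
    _ = 2 * A ^ 2 := by ring

/-- The second moment of a sum of centred indicators with predictable weights. -/
lemma bernoulliExp_sum_centredInd_sq_le (hp0 : 0 ≤ p) (hp1 : p ≤ 1) {g : E → Finset E → ℝ}
    (hins : ∀ e S, g e (insert e S) = g e S) (her : ∀ e S, g e (S.erase e) = g e S) {B : ℝ}
    (hg : ∀ e ∈ U, ∀ S, |g e S| ≤ B)
    (hg' : ∀ e ∈ U, ∀ S, ∑ f ∈ U, |discDeriv e (g f) S| ≤ 2 * B) :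
    bernoulliExp p U (fun S => (∑ e ∈ U, centredInd p e S * g e S) ^ 2) ≤
      p * (1 - p) * (U.card * (3 * B ^ 2)) := by
  have hq : 0 ≤ p * (1 - p) := mul_nonneg hp0 (sub_nonneg.2 hp1)
  simp only [sq (∑ e ∈ U, _)]
  rw [bernoulliExp_sum_centredInd_mul hins her, ← nsmul_eq_mul]
  refine mul_le_mul_of_nonneg_left (Finset.sum_le_card_nsmul _ _ _ fun e he => ?_) hq
  rw [← bernoulliExp_const (p := p) (U := U) (3 * B ^ 2)]
  refine bernoulliExp_mono hp0 hp1 fun S _ => ?_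
  have hB : 0 ≤ B := (abs_nonneg _).trans (hg e he S)
  -- The summand f = e contributes `g e S`, at most B; the others contribute at most |D_e g_f| each,
  -- 2B in total.
  have hZ : |discDeriv e (fun S => ∑ f ∈ U, centredInd p f S * g f S) S| ≤ 3 * B := by
    rw [discDeriv_sum]
    refine (Finset.abs_sum_le_sum_abs _ _).trans ?_
    have hterm : ∀ f ∈ U, |discDeriv e (fun S => centredInd p f S * g f S) S| ≤
        (if e = f then |g e S| else 0) + |discDeriv e (g f) S| := fun f _ => by
      split_ifs with h
      · subst h
        have : discDeriv e (fun S => centredInd p e S * g e S) S = g e S := by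
          simp only [discDeriv, hins, her]
          simp [centredInd]
          ring
        rw [this]
        linarith [abs_nonneg (discDeriv e (g e) S)]
      · have : discDeriv e (fun S => centredInd p f S * g f S) S =
            centredInd p f S * discDeriv e (g f) S := by
          simp only [discDeriv, centredInd_insert_of_ne p (Ne.symm h),
            centredInd_erase_of_ne p (Ne.symm h), mul_sub]
        rw [this, abs_mul, zero_add]
        exact mul_le_of_le_one_left (abs_nonneg _) (abs_centredInd_le hp0 hp1 S)
    refine (Finset.sum_le_sum hterm).trans ?_
    rw [Finset.sum_add_distrib, Finset.sum_ite_eq, if_pos he]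
    linarith [hg e he S, hg' e he S]
  calc g e S * discDeriv e (fun S => ∑ f ∈ U, centredInd p f S * g f S) S
      ≤ |g e S| * |discDeriv e (fun S => ∑ f ∈ U, centredInd p f S * g f S) S| := by
        rw [← abs_mul]; exact le_abs_self _
    _ ≤ B * (3 * B) := by
        gcongr
        exact hg e he S
    _ = 3 * B ^ 2 := by ring

/-- One of the two states compared by `discDeriv e` is S itself, so the expansion is always around W
S; if e ∉ S both increments change sign and the bound is unaffected. -/
lemma abs_mul_discDeriv_steinSol_le (z a : ℝ) (W : Finset E → ℝ) (e : E) (S : Finset E) :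
    |a * discDeriv e (fun S => steinSol z (W S)) S - a * discDeriv e W S * steinDeriv z (W S)| ≤
      |a| * discDeriv e W S * discDeriv e (fun S => steinMono z (W S)) S := by
  rw [mul_assoc, ← mul_sub, abs_mul, mul_assoc]
  refine mul_le_mul_of_nonneg_left ?_ (abs_nonneg a)
  simp only [discDeriv]
  by_cases h : e ∈ S
  · rw [Finset.insert_eq_of_mem h]
    exact abs_steinSol_sub_sub_le z _ _
  · rw [Finset.erase_eq_of_notMem h]
    have := abs_steinSol_sub_sub_le z (W S) (W (insert e S))
    rw [← abs_neg] at this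
    refine Eq.trans_le (congrArg _ ?_) (this.trans_eq ?_) <;> ring

/-- Berry–Esseen bound: if `W` is the image of `Ψ` under the number operator, then the Kolmogorov
distance of `W` to the standard normal law is controlled by the first two discrete derivatives of
`W` and `Ψ`. -/
theorem abs_bernoulliExp_sub_cdf_le (hp0 : 0 ≤ p) (hp1 : p ≤ 1) {W Ψ : Finset E → ℝ} {A : ℝ}
    (hΨ : ∀ S, ∑ e ∈ U, centredInd p e S * discDeriv e Ψ S = W S)
    (hvar : bernoulliExp p U (fun S => W S ^ 2) = 1)
    (hΨ1 : ∀ e ∈ U, ∀ S, |discDeriv e Ψ S| ≤ A) (hW1 : ∀ e ∈ U, ∀ S, |discDeriv e W S| ≤ A)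
    (hΨ2 : ∀ f ∈ U, ∀ S, ∑ e ∈ U, |discDeriv f (discDeriv e Ψ) S| ≤ A)
    (hW2 : ∀ f ∈ U, ∀ S, ∑ e ∈ U, |discDeriv f (discDeriv e W) S| ≤ A) (z : ℝ) :
    |bernoulliExp p U (fun S => if W S ≤ z then 1 else 0) - cdf (gaussianReal 0 1) z| ≤
      8 * √U.card * A ^ 2 := by
  have hq : 0 ≤ p * (1 - p) := mul_nonneg hp0 (sub_nonneg.2 hp1)
  have hq1 : p * (1 - p) ≤ 1 / 4 := by nlinarith [sq_nonneg (p - 1 / 2)]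
  set q := p * (1 - p) with hqdef
  set Γ : Finset E → ℝ := fun S => q * ∑ e ∈ U, discDeriv e Ψ S * discDeriv e W S with hΓdef
  set Z : Finset E → ℝ := fun S =>
    ∑ e ∈ U, centredInd p e S * (|discDeriv e Ψ S| * discDeriv e W S) with hZdef
  have hparts : ∀ G : Finset E → ℝ, bernoulliExp p U (fun S => W S * G S) =
      q * ∑ e ∈ U, bernoulliExp p U (fun S => discDeriv e Ψ S * discDeriv e G S) := fun G => by
    rw [← bernoulliExp_sum_centredInd_mul (fun e S => discDeriv_insert e Ψ S)
      (fun e S => discDeriv_erase e Ψ S)]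
    simp only [hΨ]
  -- Integration by parts with G = W turns E[W²] = 1 into E[Γ] = 1.
  have hΓmean : bernoulliExp p U Γ = 1 := by
    rw [hΓdef, bernoulliExp_const_mul, bernoulliExp_sum, ← hparts]
    simpa only [sq] using hvar
  have hΓderiv : ∀ f ∈ U, ∀ S, discDeriv f Γ S ^ 2 ≤ A ^ 4 := fun f hf S => by
    have h := sum_abs_discDeriv_mul_le hΨ1 hW1 (hΨ2 f hf) (hW2 f hf) S
    rw [hΓdef, discDeriv_const_mul, discDeriv_sum, ← sq_abs, abs_mul, abs_of_nonneg hq]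
    have h' := (Finset.abs_sum_le_sum_abs _ _).trans h
    have : q * |∑ e ∈ U, discDeriv f (fun S => discDeriv e Ψ S * discDeriv e W S) S| ≤ A ^ 2 :=
      (mul_le_mul hq1 h' (abs_nonneg _) (by norm_num)).trans (by nlinarith [sq_nonneg A])
    calc _ ≤ (A ^ 2) ^ 2 := pow_le_pow_left₀ (mul_nonneg hq (abs_nonneg _)) this 2
      _ = A ^ 4 := by ring
  have hΓvar : bernoulliExp p U (fun S => (Γ S - 1) ^ 2) ≤ U.card * A ^ 4 := by
    have h := bernoulliExp_poincare hp0 hp1 U Γ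
    have h2 : bernoulliExp p U (fun S => (Γ S - 1) ^ 2) =
        bernoulliExp p U (fun S => Γ S ^ 2) - bernoulliExp p U Γ ^ 2 := by
      rw [show (fun S => (Γ S - 1) ^ 2) = fun S => (Γ S ^ 2 - 2 * Γ S) + 1 by ext S; ring,
        bernoulliExp_add, bernoulliExp_sub, bernoulliExp_const_mul, bernoulliExp_const, hΓmean]
      ring
    rw [h2, ← nsmul_eq_mul]
    refine h.trans ((mul_le_of_le_one_left (Finset.sum_nonneg fun e _ => ?_)
      (by linarith)).trans (Finset.sum_le_card_nsmul _ _ _ fun e he => ?_))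
    · rw [← bernoulliExp_const (p := p) (U := U) 0]
      exact bernoulliExp_mono hp0 hp1 fun S _ => sq_nonneg _
    · rw [← bernoulliExp_const (p := p) (U := U) (A ^ 4)]
      exact bernoulliExp_mono hp0 hp1 fun S _ => hΓderiv e he S
  have hins : ∀ e S, |discDeriv e Ψ (insert e S)| * discDeriv e W (insert e S) =
      |discDeriv e Ψ S| * discDeriv e W S := fun e S => by rw [discDeriv_insert, discDeriv_insert]
  have her : ∀ e S, |discDeriv e Ψ (S.erase e)| * discDeriv e W (S.erase e) =
      |discDeriv e Ψ S| * discDeriv e W S := fun e S => by rw [discDeriv_erase, discDeriv_erase]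
  have hZvar : bernoulliExp p U (fun S => Z S ^ 2) ≤ U.card * A ^ 4 := by
    have h := bernoulliExp_sum_centredInd_sq_le (U := U) hp0 hp1 (B := A ^ 2)
      (g := fun e S => |discDeriv e Ψ S| * discDeriv e W S) hins her
      (fun e he S => ?_) (fun f hf S => ?_)
    · refine h.trans ?_
      have h0 : 0 ≤ (U.card : ℝ) * A ^ 4 := by positivity
      nlinarith
    · rw [abs_mul, abs_abs, sq]
      exact mul_le_mul (hΨ1 e he S) (hW1 e he S) (abs_nonneg _)
        ((abs_nonneg _).trans (hΨ1 e he S))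
    · exact sum_abs_discDeriv_mul_le (X := fun e S => |discDeriv e Ψ S|)
        (fun e he S => by rw [abs_abs]; exact hΨ1 e he S) hW1
        (fun S => (Finset.sum_le_sum fun e _ => abs_discDeriv_abs_le S).trans (hΨ2 f hf S))
        (hW2 f hf) S
  have hsqrt : √(U.card * A ^ 4) = √U.card * A ^ 2 := by
    rw [Real.sqrt_mul (Nat.cast_nonneg _), show A ^ 4 = (A ^ 2) ^ 2 by ring,
      Real.sqrt_sq (sq_nonneg A)]
  have hΓabs : bernoulliExp p U (fun S => |Γ S - 1|) ≤ √U.card * A ^ 2 := by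
    rw [← hsqrt]
    exact (bernoulliExp_abs_le_sqrt hp0 hp1).trans (Real.sqrt_le_sqrt hΓvar)
  have hZabs : bernoulliExp p U (fun S => |Z S|) ≤ √U.card * A ^ 2 := by
    rw [← hsqrt]
    exact (bernoulliExp_abs_le_sqrt hp0 hp1).trans (Real.sqrt_le_sqrt hZvar)
  have h1 : |bernoulliExp p U (fun S => (1 - Γ S) * steinDeriv z (W S))| ≤
      2 * (√U.card * A ^ 2) := by
    refine (abs_bernoulliExp_le hp0 hp1).trans ?_
    refine (bernoulliExp_mono (Y := fun S => 2 * |Γ S - 1|) hp0 hp1 fun S _ => ?_).trans ?_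
    · rw [abs_mul, mul_comm, abs_sub_comm]
      exact mul_le_mul_of_nonneg_right (abs_steinDeriv_le _ _) (abs_nonneg _)
    · rw [bernoulliExp_const_mul]
      linarith
  have h2 : |bernoulliExp p U (fun S => W S * steinSol z (W S)) -
      bernoulliExp p U (fun S => Γ S * steinDeriv z (W S))| ≤ 2 * (√U.card * A ^ 2) := by
    have e1 : bernoulliExp p U (fun S => Γ S * steinDeriv z (W S)) =
        q * ∑ e ∈ U, bernoulliExp p U
          (fun S => discDeriv e Ψ S * discDeriv e W S * steinDeriv z (W S)) := by
      simp only [hΓdef, mul_assoc q, Finset.sum_mul]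
      rw [bernoulliExp_const_mul, bernoulliExp_sum]
    rw [hparts, e1, ← mul_sub, ← Finset.sum_sub_distrib, abs_mul, abs_of_nonneg hq]
    calc q * |∑ e ∈ U, _|
        ≤ q * ∑ e ∈ U, bernoulliExp p U (fun S => |discDeriv e Ψ S| * discDeriv e W S *
            discDeriv e (fun S => steinMono z (W S)) S) := by
          refine mul_le_mul_of_nonneg_left ((Finset.abs_sum_le_sum_abs _ _).trans
            (Finset.sum_le_sum fun e _ => ?_)) hq
          rw [← bernoulliExp_sub]
          exact (abs_bernoulliExp_le hp0 hp1).trans (bernoulliExp_mono hp0 hp1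
            fun S _ => abs_mul_discDeriv_steinSol_le z _ W e S)
      -- Integration by parts read backwards: the derivative of the merely bounded `steinMono` is
      -- traded for the factor Z.
      _ = bernoulliExp p U (fun S => Z S * steinMono z (W S)) :=
          (bernoulliExp_sum_centredInd_mul hins her _).symm
      _ ≤ bernoulliExp p U (fun S => 2 * |Z S|) := by
          refine bernoulliExp_mono hp0 hp1 fun S _ => (le_abs_self _).trans ?_
          rw [abs_mul, mul_comm]
          exact mul_le_mul_of_nonneg_right (abs_steinMono_le _ _) (abs_nonneg _)
      _ ≤ 2 * (√U.card * A ^ 2) := by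
          rw [bernoulliExp_const_mul]
          linarith
  -- Stein's equation 1{W ≤ z} - Φ(z) = f'(W) - W f(W), with Γ f'(W) added and subtracted.
  have h3 : bernoulliExp p U (fun S => if W S ≤ z then 1 else 0) - cdf (gaussianReal 0 1) z =
      bernoulliExp p U (fun S => (1 - Γ S) * steinDeriv z (W S)) -
        (bernoulliExp p U (fun S => W S * steinSol z (W S)) -
          bernoulliExp p U (fun S => Γ S * steinDeriv z (W S))) := by
    nth_rewrite 1 [← bernoulliExp_const (p := p) (U := U) (cdf (gaussianReal 0 1) z)]
    rw [← bernoulliExp_sub, ← bernoulliExp_sub, ← bernoulliExp_sub]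
    congr 1
    ext S
    simp only [steinDeriv]
    ring
  rw [h3]
  refine (abs_sub _ _).trans ?_
  have : 0 ≤ √U.card * A ^ 2 := by positivity
  linarith

end BerryEsseen

/-! ### Counting the members of a hypergraph contained in a random set -/

section SubsetCount

variable {E ι : Type*} [DecidableEq E] {p : ℝ} {U : Finset E}

/-- The indicator that all elements of `K` are present. -/
noncomputable def containsInd (K S : Finset E) : ℝ := if K ⊆ S then 1 else 0

/-- The product of the centred indicators of the elements of `A`. -/
noncomputable def chaosTerm (p : ℝ) (A S : Finset E) : ℝ := ∏ e ∈ A, centredInd p e S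

/-- The image of the centred indicator of `K ⊆ S` under the inverse of the number operator. -/
noncomputable def inverseNumber (p : ℝ) (K S : Finset E) : ℝ :=
  ∑ A ∈ K.powerset, (A.card : ℝ)⁻¹ * p ^ (K.card - A.card) * chaosTerm p A S

lemma discDeriv_chaosTerm_of_notMem {e : E} {A : Finset E} (he : e ∉ A) (S : Finset E) :
    discDeriv e (chaosTerm p A) S = 0 := by
  refine discDeriv_eq_zero (fun S => Finset.prod_congr rfl fun f hf => ?_) S
  have hne : f ≠ e := fun h => he (h ▸ hf)
  rw [centredInd_insert_of_ne p hne, centredInd_erase_of_ne p hne]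

/-- For e ∈ A the product factors as the centred indicator of e times a term not depending on e.
Summing over e shows that `chaosTerm p A` is an eigenvector of the number operator with eigenvalue
|A|. -/
lemma centredInd_mul_discDeriv_chaosTerm (e : E) (A S : Finset E) :
    centredInd p e S * discDeriv e (chaosTerm p A) S = if e ∈ A then chaosTerm p A S else 0 := by
  split_ifs with he
  · have h : ∀ S, chaosTerm p A S = centredInd p e S * chaosTerm p (A.erase e) S := fun S =>
      (Finset.mul_prod_erase A (fun e => centredInd p e S) he).symm
    have h0 := discDeriv_chaosTerm_of_notMem (p := p) (Finset.notMem_erase e A) S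
    rw [discDeriv, sub_eq_zero] at h0
    have h1 : chaosTerm p (A.erase e) (S.erase e) = chaosTerm p (A.erase e) S := by
      by_cases h : e ∈ S
      · rw [← h0, Finset.insert_eq_of_mem h]
      · rw [Finset.erase_eq_of_notMem h]
    rw [discDeriv, h, h (S.erase e), h0, h S, ← sub_mul, h1]
    simp [centredInd]
  · rw [discDeriv_chaosTerm_of_notMem he, mul_zero]

/-- Write each indicator as its centred version plus p and expand the product. -/
lemma containsInd_eq_sum_chaosTerm (p : ℝ) (K S : Finset E) :
    containsInd K S = ∑ A ∈ K.powerset, p ^ (K.card - A.card) * chaosTerm p A S := by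
  have h := Finset.prod_add (fun e => centredInd p e S) (fun _ => p) K
  have h1 : ∏ e ∈ K, (centredInd p e S + p) = containsInd K S := by
    simp [centredInd, containsInd, Finset.prod_ite_zero, Finset.subset_iff]
  rw [← h1, h]
  refine Finset.sum_congr rfl fun A hA => ?_
  rw [Finset.prod_const, Finset.card_sdiff_of_subset (Finset.mem_powerset.1 hA), mul_comm,
    chaosTerm]

lemma sum_centredInd_mul_discDeriv_inverseNumber {K : Finset E} (hK : K ⊆ U) (S : Finset E) :
    ∑ e ∈ U, centredInd p e S * discDeriv e (inverseNumber p K) S =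
      containsInd K S - p ^ K.card := by
  have h1 : ∀ e, centredInd p e S * discDeriv e (inverseNumber p K) S =
      ∑ A ∈ K.powerset, (A.card : ℝ)⁻¹ * p ^ (K.card - A.card) *
        if e ∈ A then chaosTerm p A S else 0 := fun e => by
    unfold inverseNumber
    rw [discDeriv_sum, Finset.mul_sum]
    refine Finset.sum_congr rfl fun A _ => ?_
    rw [discDeriv_const_mul, mul_left_comm, centredInd_mul_discDeriv_chaosTerm]
  -- The eigenvalue |A| cancels |A|⁻¹ unless A = ∅; there 0⁻¹ = 0 drops the constant term, which is
  -- the mean p^|K|.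
  have h2 : ∀ A ∈ K.powerset, ∑ e ∈ U, (A.card : ℝ)⁻¹ * p ^ (K.card - A.card) *
      (if e ∈ A then chaosTerm p A S else 0) =
      p ^ (K.card - A.card) * chaosTerm p A S - if A = ∅ then p ^ K.card else 0 := fun A hA => by
    rw [← Finset.mul_sum, ← Finset.sum_filter, Finset.filter_mem_eq_inter,
      Finset.inter_eq_right.2 ((Finset.mem_powerset.1 hA).trans hK), Finset.sum_const,
      nsmul_eq_mul]
    split_ifs with h
    · simp [h, chaosTerm]
    · have : (A.card : ℝ) ≠ 0 := by simpa using h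
      field_simp
      ring
  rw [containsInd_eq_sum_chaosTerm p, Finset.sum_congr rfl fun e _ => h1 e, Finset.sum_comm,
    Finset.sum_congr rfl h2, Finset.sum_sub_distrib]
  simp

lemma abs_chaosTerm_le (hp0 : 0 ≤ p) (hp1 : p ≤ 1) (A S : Finset E) : |chaosTerm p A S| ≤ 1 := by
  rw [chaosTerm, Finset.abs_prod]
  exact Finset.prod_le_one (fun _ _ => abs_nonneg _) fun _ _ => abs_centredInd_le hp0 hp1 S

lemma abs_inverseNumber_le (hp0 : 0 ≤ p) (hp1 : p ≤ 1) (K S : Finset E) :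
    |inverseNumber p K S| ≤ 2 ^ K.card := by
  have h : ∀ A ∈ K.powerset,
      |(A.card : ℝ)⁻¹ * p ^ (K.card - A.card) * chaosTerm p A S| ≤ 1 := fun A _ => by
    rw [abs_mul, abs_mul, abs_of_nonneg (by positivity : (0 : ℝ) ≤ (A.card : ℝ)⁻¹),
      abs_of_nonneg (pow_nonneg hp0 _)]
    exact mul_le_one₀ (mul_le_one₀ (Nat.cast_inv_le_one _) (pow_nonneg hp0 _)
      (pow_le_one₀ hp0 hp1)) (abs_nonneg _) (abs_chaosTerm_le hp0 hp1 A S)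
  refine (Finset.abs_sum_le_sum_abs _ _).trans ((Finset.sum_le_card_nsmul _ _ _ h).trans ?_)
  simp [Finset.card_powerset]

lemma discDeriv_inverseNumber_of_notMem {e : E} {K : Finset E} (he : e ∉ K) (S : Finset E) :
    discDeriv e (inverseNumber p K) S = 0 := by
  unfold inverseNumber
  rw [discDeriv_sum]
  refine Finset.sum_eq_zero fun A hA => ?_
  rw [discDeriv_const_mul, discDeriv_chaosTerm_of_notMem fun h => he (Finset.mem_powerset.1 hA h),
    mul_zero]

lemma discDeriv_containsInd_of_notMem {e : E} {K : Finset E} (he : e ∉ K) (S : Finset E) :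
    discDeriv e (containsInd K) S = 0 := by
  refine discDeriv_eq_zero (fun S => ?_) S
  simp only [containsInd, Finset.subset_insert_iff_of_notMem he, Finset.subset_erase, he,
    not_false_eq_true, and_true]

lemma abs_containsInd_le (K S : Finset E) : |containsInd K S| ≤ 1 := by
  unfold containsInd
  split_ifs <;> simp

section LocalSums

variable {I : Finset ι} {K : ι → Finset E} {φ : ι → Finset E → ℝ} {m : ℕ} {M c : ℝ}

lemma abs_discDeriv_le {X : Finset E → ℝ} (h : ∀ S, |X S| ≤ c) (e : E) (S : Finset E) :
    |discDeriv e X S| ≤ 2 * c :=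
  (abs_sub _ _).trans (by linarith [h (insert e S), h (S.erase e)])

lemma abs_discDeriv_sum_le (hc : 0 ≤ c) (hφ : ∀ i ∈ I, ∀ S, |φ i S| ≤ c)
    (hloc : ∀ i ∈ I, ∀ e, e ∉ K i → ∀ S, discDeriv e (φ i) S = 0)
    {e : E} (hM : ((I.filter (e ∈ K ·)).card : ℝ) ≤ M) (S : Finset E) :
    |discDeriv e (fun S => ∑ i ∈ I, φ i S) S| ≤ 2 * c * M := by
  rw [discDeriv_sum]
  calc |∑ i ∈ I, discDeriv e (φ i) S|
      ≤ ∑ i ∈ I, if e ∈ K i then 2 * c else 0 := by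
        refine (Finset.abs_sum_le_sum_abs _ _).trans (Finset.sum_le_sum fun i hi => ?_)
        split_ifs with h
        · exact abs_discDeriv_le (hφ i hi) e S
        · rw [hloc i hi e h, abs_zero]
    _ = (I.filter (e ∈ K ·)).card * (2 * c) := by
        rw [← Finset.sum_filter, Finset.sum_const, nsmul_eq_mul]
    _ ≤ M * (2 * c) := by gcongr
    _ = 2 * c * M := by ring

/-- The mixed derivative of `φ i` vanishes unless both e and f lie in `K i`, so each of the at most
M members through f accounts for at most m values of e. -/
lemma sum_abs_discDeriv_discDeriv_sum_le (hc : 0 ≤ c) (hφ : ∀ i ∈ I, ∀ S, |φ i S| ≤ c)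
    (hloc : ∀ i ∈ I, ∀ e, e ∉ K i → ∀ S, discDeriv e (φ i) S = 0)
    (hm : ∀ i ∈ I, (K i).card ≤ m)
    {f : E} (hM : ((I.filter (f ∈ K ·)).card : ℝ) ≤ M) (S : Finset E) :
    ∑ e ∈ U, |discDeriv f (discDeriv e (fun S => ∑ i ∈ I, φ i S)) S| ≤ 4 * c * m * M := by
  have hterm : ∀ e ∈ U, |discDeriv f (discDeriv e (fun S => ∑ i ∈ I, φ i S)) S| ≤
      ∑ i ∈ I, if f ∈ K i then (if e ∈ K i then 4 * c else 0) else 0 := fun e _ => by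
    have h1 : discDeriv e (fun S => ∑ i ∈ I, φ i S) = fun S => ∑ i ∈ I, discDeriv e (φ i) S :=
      funext fun S => discDeriv_sum I φ S
    rw [h1, discDeriv_sum]
    refine (Finset.abs_sum_le_sum_abs _ _).trans (Finset.sum_le_sum fun i hi => ?_)
    split_ifs with hf he
    · refine (abs_discDeriv_le (abs_discDeriv_le (hφ i hi) e) f S).trans_eq ?_
      ring
    · rw [discDeriv_eq_zero fun S => ?_, abs_zero]
      rw [hloc i hi e he, hloc i hi e he]
    · rw [discDeriv_comm, discDeriv_eq_zero fun S => ?_, abs_zero]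
      rw [hloc i hi f hf, hloc i hi f hf]
  calc ∑ e ∈ U, |discDeriv f (discDeriv e (fun S => ∑ i ∈ I, φ i S)) S|
      ≤ ∑ e ∈ U, ∑ i ∈ I, if f ∈ K i then (if e ∈ K i then 4 * c else 0) else 0 :=
        Finset.sum_le_sum hterm
    _ ≤ ∑ i ∈ I, if f ∈ K i then m * (4 * c) else 0 := by
        rw [Finset.sum_comm]
        refine Finset.sum_le_sum fun i hi => ?_
        split_ifs
        · rw [← Finset.sum_filter, Finset.sum_const, nsmul_eq_mul, Finset.filter_mem_eq_inter]
          gcongr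
          exact (Finset.card_le_card Finset.inter_subset_right).trans (hm i hi)
        · simp
    _ = (I.filter (f ∈ K ·)).card * (m * (4 * c)) := by
        rw [← Finset.sum_filter, Finset.sum_const, nsmul_eq_mul]
    _ ≤ M * (m * (4 * c)) := by gcongr
    _ = 4 * c * m * M := by ring

end LocalSums

/-- The number of members of the family `K i`, `i ∈ I`, that are contained in `S`. -/
noncomputable def subsetCount (I : Finset ι) (K : ι → Finset E) (S : Finset E) : ℝ :=
  ∑ i ∈ I, containsInd (K i) S

/-- The variance of a function of a random subset of `U`. -/
noncomputable def bernoulliVar (p : ℝ) (U : Finset E) (X : Finset E → ℝ) : ℝ :=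
  bernoulliExp p U fun S => (X S - bernoulliExp p U X) ^ 2

/-- Integration by parts against the constant 1 shows that the centred indicator has mean zero. -/
lemma bernoulliExp_containsInd {K : Finset E} (hK : K ⊆ U) :
    bernoulliExp p U (containsInd K) = p ^ K.card := by
  have h := bernoulliExp_sum_centredInd_mul (p := p) (U := U)
    (fun e S => discDeriv_insert e (inverseNumber p K) S)
    (fun e S => discDeriv_erase e (inverseNumber p K) S) (fun _ => 1)
  have h0 : ∀ e : E, discDeriv e (fun _ => (1 : ℝ)) = fun _ => 0 :=
    fun e => funext fun S => discDeriv_eq_zero (fun _ => rfl) S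
  simp only [sum_centredInd_mul_discDeriv_inverseNumber hK, mul_one, h0, mul_zero,
    bernoulliExp_const, Finset.sum_const_zero] at h
  rw [bernoulliExp_sub, bernoulliExp_const] at h
  linarith

variable {I : Finset ι} {K : ι → Finset E} {m : ℕ} {M : ℝ}

lemma containsInd_le_discDeriv {e : E} {K : Finset E} (he : e ∈ K) (S : Finset E) :
    containsInd K S ≤ discDeriv e (containsInd K) S := by
  have h : ¬ K ⊆ S.erase e := fun h => Finset.notMem_erase e S (h he)
  simp only [discDeriv, containsInd, if_neg h, sub_zero]
  split_ifs with h1 h2 <;> first | exact absurd (h1.trans (Finset.subset_insert e S)) h2 | norm_num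

/-- A lower bound for the variance of `subsetCount`, by comparison with the total number of
elements. -/
lemma le_card_mul_bernoulliVar_subsetCount (hp0 : 0 < p) (hp1 : p < 1)
    (hU : ∀ i ∈ I, K i ⊆ U) (hne : ∀ i ∈ I, (K i).Nonempty) (hm : ∀ i ∈ I, (K i).card ≤ m) :
    p * (1 - p) * (I.card * p ^ m) ^ 2 ≤ U.card * bernoulliVar p U (subsetCount I K) := by
  have hq : 0 < p * (1 - p) := mul_pos hp0 (sub_pos.2 hp1)
  set L : Finset E → ℝ := fun S => ∑ e ∈ U, centredInd p e S with hL
  set T := subsetCount I K with hT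
  have hparts : ∀ G : Finset E → ℝ, bernoulliExp p U (fun S => L S * G S) =
      p * (1 - p) * ∑ e ∈ U, bernoulliExp p U (discDeriv e G) := fun G => by
    have h := bernoulliExp_sum_centredInd_mul (p := p) (U := U) (g := fun _ _ => 1)
      (fun _ _ => rfl) (fun _ _ => rfl) G
    simpa only [mul_one, one_mul] using h
  have hLL : bernoulliExp p U (fun S => L S ^ 2) = p * (1 - p) * U.card := by
    simp only [sq]
    rw [hparts]
    congr 1
    have : ∀ e ∈ U, bernoulliExp p U (discDeriv e L) = 1 := fun e he => by
      have h1 : discDeriv e L = fun _ => 1 := funext fun S => by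
        rw [hL, discDeriv_sum, Finset.sum_eq_single e (fun f _ hf => ?_) (fun h => absurd he h),
          discDeriv_centredInd_self]
        refine discDeriv_eq_zero (fun S => ?_) S
        rw [centredInd_insert_of_ne p hf, centredInd_erase_of_ne p hf]
      rw [h1, bernoulliExp_const]
    rw [Finset.sum_congr rfl this, Finset.sum_const, nsmul_eq_mul, mul_one]
  have hderiv : ∀ i ∈ I, ∀ e ∈ U, (if e ∈ K i then p ^ m else 0) ≤
      bernoulliExp p U (discDeriv e (containsInd (K i))) := fun i hi e _ => by
    split_ifs with he
    · calc p ^ m ≤ p ^ (K i).card := pow_le_pow_of_le_one hp0.le hp1.le (hm i hi)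
        _ = bernoulliExp p U (containsInd (K i)) := (bernoulliExp_containsInd (hU i hi)).symm
        _ ≤ _ := bernoulliExp_mono hp0.le hp1.le fun S _ => containsInd_le_discDeriv he S
    · have h0 : discDeriv e (containsInd (K i)) = fun _ => 0 :=
        funext fun S => discDeriv_containsInd_of_notMem he S
      rw [h0, bernoulliExp_const]
  -- Covariance with the number of elements: all derivatives of the indicators have nonnegative
  -- mean, so a single e in each `K i` already contributes p^m.
  have hcov : p * (1 - p) * (I.card * p ^ m) ≤
      bernoulliExp p U (fun S => L S * (T S - bernoulliExp p U T)) := by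
    rw [hparts]
    refine mul_le_mul_of_nonneg_left ?_ hq.le
    have h1 : ∀ e, discDeriv e (fun S => T S - bernoulliExp p U T) =
        fun S => ∑ i ∈ I, discDeriv e (containsInd (K i)) S := fun e => funext fun S => by
      rw [← discDeriv_sum]
      simp only [discDeriv, hT, subsetCount]
      ring
    simp only [h1]
    simp only [bernoulliExp_sum]
    rw [Finset.sum_comm, ← nsmul_eq_mul, ← Finset.sum_const]
    refine Finset.sum_le_sum fun i hi => ?_
    obtain ⟨e, he⟩ := hne i hi
    calc p ^ m = if e ∈ K i then p ^ m else 0 := (if_pos he).symm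
      _ ≤ ∑ e ∈ U, if e ∈ K i then p ^ m else 0 :=
        Finset.single_le_sum (f := fun e => if e ∈ K i then p ^ m else 0)
          (fun e _ => by positivity) (hU i hi he)
      _ ≤ _ := Finset.sum_le_sum (hderiv i hi)
  have hcs := bernoulliExp_mul_sq_le (X := L) (Y := fun S => T S - bernoulliExp p U T) (U := U)
    hp0.le hp1.le
  have hsq := (pow_le_pow_left₀ (by positivity) hcov 2).trans hcs
  rw [hLL] at hsq
  have h : p * (1 - p) * (p * (1 - p) * (I.card * p ^ m) ^ 2) ≤
      p * (1 - p) * (U.card * bernoulliVar p U T) := by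
    rw [bernoulliVar]
    linarith
  exact le_of_mul_le_mul_left h hq

/-- A Berry–Esseen bound for the number of members of a hypergraph contained in a random set. -/
theorem subsetCount_berryEsseen (hp0 : 0 ≤ p) (hp1 : p ≤ 1)
    (hU : ∀ i ∈ I, K i ⊆ U) (hm1 : 1 ≤ m) (hm : ∀ i ∈ I, (K i).card ≤ m)
    (hM : ∀ e ∈ U, ((I.filter (e ∈ K ·)).card : ℝ) ≤ M)
    (hV : 0 < bernoulliVar p U (subsetCount I K)) (z : ℝ) :
    |bernoulliExp p U (fun S => if (subsetCount I K S - bernoulliExp p U (subsetCount I K)) /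
        √(bernoulliVar p U (subsetCount I K)) ≤ z then 1 else 0) - cdf (gaussianReal 0 1) z| ≤
      8 * √U.card * ((4 * 2 ^ m * m * M) ^ 2 / bernoulliVar p U (subsetCount I K)) := by
  set T := subsetCount I K with hT
  set V := bernoulliVar p U T with hVdef
  set Ψ : Finset E → ℝ := fun S => ∑ i ∈ I, inverseNumber p (K i) S with hΨdef
  have hs : 0 < √V := Real.sqrt_pos.2 hV
  have hmean : bernoulliExp p U T = ∑ i ∈ I, p ^ (K i).card := by
    have : T = fun S => ∑ i ∈ I, containsInd (K i) S := rfl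
    rw [this, bernoulliExp_sum]
    exact Finset.sum_congr rfl fun i hi => bernoulliExp_containsInd (hU i hi)
  have hΨ : ∀ S, ∑ e ∈ U, centredInd p e S * discDeriv e Ψ S = T S - bernoulliExp p U T :=
    fun S => by
      simp only [hΨdef, discDeriv_sum, Finset.mul_sum]
      rw [Finset.sum_comm, hmean, hT, subsetCount, ← Finset.sum_sub_distrib]
      exact Finset.sum_congr rfl fun i hi =>
        sum_centredInd_mul_discDeriv_inverseNumber (hU i hi) S
  have hc : (0 : ℝ) ≤ 2 ^ m := by positivity
  have hφΨ : ∀ i ∈ I, ∀ S, |inverseNumber p (K i) S| ≤ 2 ^ m := fun i hi S =>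
    (abs_inverseNumber_le hp0 hp1 _ S).trans (pow_le_pow_right₀ one_le_two (hm i hi))
  have hφT : ∀ i ∈ I, ∀ S, |containsInd (K i) S| ≤ 2 ^ m := fun i hi S =>
    (abs_containsInd_le _ S).trans (one_le_pow₀ one_le_two)
  have hlocΨ : ∀ i ∈ I, ∀ e, e ∉ K i → ∀ S, discDeriv e (inverseNumber p (K i)) S = 0 :=
    fun i _ e he S => discDeriv_inverseNumber_of_notMem he S
  have hlocT : ∀ i ∈ I, ∀ e, e ∉ K i → ∀ S, discDeriv e (containsInd (K i)) S = 0 :=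
    fun i _ e he S => discDeriv_containsInd_of_notMem he S
  -- Since m ≥ 1, the second-derivative bound dominates the first-derivative one, and a single A
  -- serves all four hypotheses.
  have hfirst : ∀ e ∈ U, 2 * 2 ^ m * M ≤ 4 * 2 ^ m * m * M := fun e he => by
    have hM0 : 0 ≤ M := (Nat.cast_nonneg _).trans (hM e he)
    have : (1 : ℝ) ≤ m := by exact_mod_cast hm1
    nlinarith [mul_nonneg (mul_nonneg hc hM0) (sub_nonneg.2 this), mul_nonneg hc hM0]
  have hscale : ∀ (X : Finset E → ℝ) (e : E), discDeriv e (fun S => (√V)⁻¹ * X S) =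
      fun S => (√V)⁻¹ * discDeriv e X S := fun X e => funext fun S => discDeriv_const_mul _ S
  have hb : ∀ {x y : ℝ}, |x| ≤ y → |(√V)⁻¹ * x| ≤ y / √V := fun {x y} h => by
    rw [abs_mul, abs_of_nonneg (inv_nonneg.2 hs.le), div_eq_inv_mul]
    exact mul_le_mul_of_nonneg_left h (inv_nonneg.2 hs.le)
  have hb2 : ∀ {x : E → ℝ} {y : ℝ}, ∑ e ∈ U, |x e| ≤ y → ∑ e ∈ U, |(√V)⁻¹ * x e| ≤ y / √V :=
    fun {x y} h => by
      simp only [abs_mul, abs_of_nonneg (inv_nonneg.2 hs.le), ← Finset.mul_sum]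
      rw [div_eq_inv_mul]
      exact mul_le_mul_of_nonneg_left h (inv_nonneg.2 hs.le)
  have hT' : ∀ e, discDeriv e (fun S => T S - bernoulliExp p U T) =
      discDeriv e (fun S => ∑ i ∈ I, containsInd (K i) S) := fun e => funext fun S => by
    simp only [discDeriv, hT, subsetCount]
    ring
  have key := abs_bernoulliExp_sub_cdf_le (U := U) hp0 hp1
    (W := fun S => (√V)⁻¹ * (T S - bernoulliExp p U T)) (Ψ := fun S => (√V)⁻¹ * Ψ S)
    (A := 4 * 2 ^ m * m * M / √V) (fun S => ?_) ?_ (fun e he S => ?_) (fun e he S => ?_)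
    (fun f hf S => ?_) (fun f hf S => ?_) z
  · simp only [← div_eq_inv_mul] at key
    rwa [div_pow _ (√V), Real.sq_sqrt hV.le] at key
  · simp only [hscale, mul_left_comm _ (√V)⁻¹]
    rw [← Finset.mul_sum, hΨ]
  · simp only [mul_pow]
    rw [bernoulliExp_const_mul, inv_pow, Real.sq_sqrt hV.le]
    exact inv_mul_cancel₀ hV.ne'
  · rw [hscale]
    exact hb ((abs_discDeriv_sum_le hc hφΨ hlocΨ (hM e he) S).trans (hfirst e he))
  · rw [hscale, hT']
    exact hb ((abs_discDeriv_sum_le hc hφT hlocT (hM e he) S).trans (hfirst e he))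
  · simp only [hscale]
    exact hb2 (sum_abs_discDeriv_discDeriv_sum_le hc hφΨ hlocΨ hm (hM f hf) S)
  · simp only [hscale, hT']
    exact hb2 (sum_abs_discDeriv_discDeriv_sum_le hc hφT hlocT hm (hM f hf) S)

end SubsetCount

/-! ### Subgraph counts in the binomial random graph -/

section RandomGraph

/-- On a finite vertex set this makes every function of the graph measurable and turns integrals
into finite sums. -/
instance {V : Type*} [Countable V] : MeasurableSingletonClass (SimpleGraph V) where
  measurableSet_singleton G := by
    have h : ({G} : Set (SimpleGraph V)) = SimpleGraph.edgeSet ⁻¹' {G.edgeSet} := by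
      ext H
      simp
    rw [h]
    exact SimpleGraph.measurable_edgeSet (measurableSet_singleton _)

open scoped Classical in
/-- Expectations with respect to the binomial random graph are expectations over a random set of
edges. -/
lemma integral_binomialRandom {n : ℕ} (p : unitInterval) {X : SimpleGraph (Fin n) → ℝ}
    {Y : Finset (Sym2 (Fin n)) → ℝ} (h : ∀ G : SimpleGraph (Fin n), X G = Y G.edgeFinset) :
    ∫ G, X G ∂(SimpleGraph.binomialRandom (Fin n) p) =
      bernoulliExp p (⊤ : SimpleGraph (Fin n)).edgeFinset Y := by
  rw [integral_fintype .of_finite, bernoulliExp]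
  refine Finset.sum_bij' (fun G _ => G.edgeFinset) (fun S _ => SimpleGraph.fromEdgeSet (S : Set _))
    (fun G _ => Finset.mem_powerset.2 (SimpleGraph.edgeFinset_mono le_top)) (fun S _ => by simp)
    (fun G _ => by simp) (fun S hS => ?_) fun G _ => ?_
  · have hS' : ∀ e ∈ S, ¬ e.IsDiag := fun e he => by
      simpa using Finset.mem_powerset.1 hS he
    ext e
    simp only [SimpleGraph.mem_edgeFinset, SimpleGraph.edgeSet_fromEdgeSet, Set.mem_sdiff,
      Finset.mem_coe]
    exact ⟨fun h => h.1, fun h => ⟨h, hS' e h⟩⟩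
  · have hc : G.edgeSet.ncard = G.edgeFinset.card := by
      rw [SimpleGraph.edgeFinset, Set.ncard_eq_toFinset_card']
    rw [h, smul_eq_mul, measureReal_def, SimpleGraph.binomialRandom_singleton, hc,
      SimpleGraph.card_edgeFinset_top_eq_card_choose_two]
    simp

variable {V : Type*} [Fintype V] {F : SimpleGraph V} {n : ℕ}

open scoped Classical in
/-- The copies of `F` whose vertex set is `Fin (Fintype.card V)`. -/
noncomputable def copiesOn (F : SimpleGraph V) : Finset (SimpleGraph (Fin (Fintype.card V))) :=
  Finset.univ.filter fun H => Nonempty (H ≃g F)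

/-- The index set of the copies of `F` in the complete graph on `Fin n`. -/
noncomputable def copyIndex (F : SimpleGraph V) (n : ℕ) :
    Finset ((Fin (Fintype.card V) ↪o Fin n) × SimpleGraph (Fin (Fintype.card V))) :=
  Finset.univ ×ˢ copiesOn F

open scoped Classical in
/-- The edge set of the copy of `F` with a given index. -/
noncomputable def copyEdges {k n : ℕ} (i : (Fin k ↪o Fin n) × SimpleGraph (Fin k)) : Finset (Sym2 (Fin n)) :=
  i.2.edgeFinset.image (Sym2.map i.1)

open scoped Classical in
-- A product of 0/1 indicators is the indicator that all edges are present. Indices are counted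
-- rather than edge sets: if F has isolated vertices, different indices may share an edge set.
lemma injCount_eq_subsetCount (F : SimpleGraph V) (G : SimpleGraph (Fin n)) :
    injCount F G = subsetCount (copyIndex F n) copyEdges G.edgeFinset := by
  unfold injCount injKernel subsetCount copyIndex copiesOn
  rw [Finset.sum_product]
  refine Finset.sum_congr rfl fun α _ => Finset.sum_congr rfl fun H _ => ?_
  simp [edgeIndicator, containsInd, copyEdges, Finset.prod_ite_zero, Finset.subset_iff]

lemma copyEdges_subset {k : ℕ} (i : (Fin k ↪o Fin n) × SimpleGraph (Fin k)) [DecidableEq (Fin n)]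
    [Fintype (⊤ : SimpleGraph (Fin n)).edgeSet] :
    copyEdges i ⊆ (⊤ : SimpleGraph (Fin n)).edgeFinset := by
  intro e he
  simp only [copyEdges, Finset.mem_image, SimpleGraph.mem_edgeFinset] at he
  obtain ⟨f, hf, rfl⟩ := he
  induction f with
  | _ a b =>
    have := i.2.ne_of_adj hf
    simpa using this

lemma copyEdges_card_le {k : ℕ} (i : (Fin k ↪o Fin n) × SimpleGraph (Fin k)) :
    (copyEdges i).card ≤ k.choose 2 := by
  classical
  refine Finset.card_image_le.trans ?_
  simpa using i.2.card_edgeFinset_le_card_choose_two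

lemma copyEdges_nonempty (hF : F ≠ ⊥)
    {i : (Fin (Fintype.card V) ↪o Fin n) × SimpleGraph (Fin (Fintype.card V))}
    (hi : i ∈ copyIndex F n) : (copyEdges i).Nonempty := by
  classical
  simp only [copyIndex, copiesOn, Finset.mem_product, Finset.mem_filter, Finset.mem_univ,
    true_and] at hi
  obtain ⟨φ⟩ := hi
  obtain ⟨a, b, hab⟩ := SimpleGraph.ne_bot_iff_exists_adj.1 hF
  refine Finset.Nonempty.image ⟨s(φ.symm a, φ.symm b), ?_⟩ _
  rw [SimpleGraph.mem_edgeFinset, SimpleGraph.mem_edgeSet]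
  exact φ.symm.map_adj_iff.2 hab

/-! ### Counting copies, and copies through a given edge -/

lemma copiesOn_nonempty (F : SimpleGraph V) : (copiesOn F).Nonempty := by
  classical
  exact ⟨F.overFin rfl, Finset.mem_filter.2 ⟨Finset.mem_univ _, ⟨(F.overFinIso rfl).symm⟩⟩⟩

lemma card_fin_orderEmbedding (k n : ℕ) : Fintype.card (Fin k ↪o Fin n) = n.choose k := by
  rw [Fintype.card_eq_nat_card, Nat.card_congr Set.powersetCard.ofFinEmbEquiv,
    Set.powersetCard.card, Nat.card_eq_fintype_card, Fintype.card_fin]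

lemma card_copyIndex (F : SimpleGraph V) (n : ℕ) :
    (copyIndex F n).card = n.choose (Fintype.card V) * (copiesOn F).card := by
  rw [copyIndex, Finset.card_product, Finset.card_univ, card_fin_orderEmbedding]

open scoped Classical in
-- An order embedding is determined by its range; removing a and b from the range leaves a
-- (k-2)-subset of the other n-2 points.
lemma card_orderEmbedding_through_le {k n : ℕ} {a b : Fin n} (hab : a ≠ b) :
    (Finset.univ.filter fun α : Fin k ↪o Fin n => a ∈ Set.range α ∧ b ∈ Set.range α).card ≤
      (n - 2).choose (k - 2) := by
  have hcard : (((Finset.univ : Finset (Fin n)).erase a).erase b).card = n - 2 := by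
    rw [Finset.card_erase_of_mem (by simp [hab.symm]), Finset.card_erase_of_mem (by simp)]
    simp
    omega
  rw [← hcard, ← Finset.card_powersetCard]
  refine Finset.card_le_card_of_injOn
    (fun α => ((Finset.univ.map α.toEmbedding).erase a).erase b) (fun α hα => ?_)
    fun α hα β hβ h => ?_
  · simp only [Finset.coe_filter, Finset.mem_univ, true_and, Set.mem_ofPred_eq] at hα
    rw [Finset.mem_coe, Finset.mem_powersetCard]
    refine ⟨Finset.erase_subset_erase _ (Finset.erase_subset_erase _ (Finset.subset_univ _)), ?_⟩
    rw [Finset.card_erase_of_mem, Finset.card_erase_of_mem]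
    · simp
      omega
    · simpa using hα.1
    · simpa [hab.symm] using hα.2
  · simp only [Finset.coe_filter, Finset.mem_univ, true_and, Set.mem_ofPred_eq] at hα hβ
    rw [← OrderEmbedding.range_inj]
    ext c
    by_cases hca : c = a
    · subst hca; exact iff_of_true hα.1 hβ.1
    by_cases hcb : c = b
    · subst hcb; exact iff_of_true hα.2 hβ.2
    have := Finset.ext_iff.1 h c
    simpa [hca, hcb] using this

open scoped Classical in
lemma card_copyIndex_through_le (F : SimpleGraph V) {e : Sym2 (Fin n)} (he : ¬ e.IsDiag) :
    ((copyIndex F n).filter (e ∈ copyEdges ·)).card ≤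
      (n - 2).choose (Fintype.card V - 2) * (copiesOn F).card := by
  induction e with
  | _ a b =>
    have hab : a ≠ b := by simpa using he
    refine le_trans (Finset.card_le_card (t := (Finset.univ.filter fun α :
      Fin (Fintype.card V) ↪o Fin n => a ∈ Set.range α ∧ b ∈ Set.range α) ×ˢ copiesOn F) ?_) ?_
    · rintro ⟨α, H⟩ hi
      simp only [copyIndex, Finset.mem_filter, Finset.mem_product, Finset.mem_univ, true_and,
        copyEdges, Finset.mem_image] at hi ⊢
      obtain ⟨hH, f, -, hf⟩ := hi
      refine ⟨?_, hH⟩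
      induction f with
      | _ c d =>
        rw [Sym2.map_mk, Sym2.eq_iff] at hf
        rcases hf with ⟨rfl, rfl⟩ | ⟨rfl, rfl⟩ <;> simp
    · rw [Finset.card_product]
      exact Nat.mul_le_mul_right _ (card_orderEmbedding_through_le hab)

lemma choose_sub_two_mul {n k : ℕ} (hk : 2 ≤ k) (hn : 2 ≤ n) :
    n * (n - 1) * (n - 2).choose (k - 2) = n.choose k * (k * (k - 1)) := by
  obtain ⟨k, rfl⟩ := Nat.exists_eq_add_of_le' hk
  obtain ⟨n, rfl⟩ := Nat.exists_eq_add_of_le' hn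
  have h1 := Nat.add_one_mul_choose_eq n k
  have h2 := Nat.add_one_mul_choose_eq (n + 1) (k + 1)
  simp only [Nat.add_sub_cancel, show n + 2 - 1 = n + 1 by omega, show k + 2 - 1 = k + 1 by omega]
  calc (n + 2) * (n + 1) * n.choose k = (n + 2) * ((n + 1) * n.choose k) := by ring
    _ = (n + 1 + 1) * (n + 1).choose (k + 1) * (k + 1) := by rw [h1]; ring
    _ = _ := by rw [h2]; ring

/-- A given pair lies in a proportion O(n⁻²) of all k-subsets; the factor 2 comes from n ≤ 2(n-1).
-/
lemma sq_mul_choose_sub_two_le {n k : ℕ} (hk : 2 ≤ k) (hn : 2 ≤ n) :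
    n ^ 2 * (n - 2).choose (k - 2) ≤ 2 * k ^ 2 * n.choose k := by
  have h := choose_sub_two_mul hk hn
  calc n ^ 2 * (n - 2).choose (k - 2) ≤ 2 * (n * (n - 1) * (n - 2).choose (k - 2)) := by
        have : n ≤ 2 * (n - 1) := by omega
        calc n ^ 2 * (n - 2).choose (k - 2) = n * (n - 2).choose (k - 2) * n := by ring
          _ ≤ n * (n - 2).choose (k - 2) * (2 * (n - 1)) := Nat.mul_le_mul_left _ this
          _ = _ := by ring
    _ = 2 * (n.choose k * (k * (k - 1))) := by rw [h]
    _ ≤ 2 * (n.choose k * (k * k)) := by gcongr; omega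
    _ = _ := by ring

/-- The final estimate: the variance lower bound turns the general Berry–Esseen bound into a bound
of order `1 / n`. -/
lemma berryEsseen_bound_le {q P B M L N W κ n : ℝ} (hq : 0 < q) (hP : 0 < P)
    (hL : 0 < L) (hn : 0 < n) (hM : 0 ≤ M) (hN : N ≤ n ^ 2)
    (hML : n ^ 2 * M ≤ κ * L) (hW : q * (L * P) ^ 2 ≤ N * W) (hW0 : 0 < W) :
    8 * √N * ((B * M) ^ 2 / W) ≤ 8 * B ^ 2 * κ ^ 2 / (q * P ^ 2) / n := by
  have hs : √N ≤ n := Real.sqrt_le_iff.2 ⟨hn.le, hN⟩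
  have h1 : q * (L * P) ^ 2 ≤ n ^ 2 * W := hW.trans (mul_le_mul_of_nonneg_right hN hW0.le)
  have h2 : (n ^ 2 * M) ^ 2 ≤ (κ * L) ^ 2 := pow_le_pow_left₀ (by positivity) hML 2
  have h3 : M ^ 2 / W ≤ κ ^ 2 / (q * P ^ 2) / n ^ 2 := by
    rw [div_div, div_le_div_iff₀ hW0 (by positivity)]
    have h4 : (n ^ 2 * M) ^ 2 * (q * (L * P) ^ 2) ≤ (κ * L) ^ 2 * (n ^ 2 * W) :=
      mul_le_mul h2 h1 (by positivity) (by positivity)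
    have h5 : (n ^ 2 * L ^ 2) * (M ^ 2 * (q * P ^ 2 * n ^ 2)) ≤ (n ^ 2 * L ^ 2) * (κ ^ 2 * W) := by
      linarith
    exact le_of_mul_le_mul_left h5 (by positivity)
  calc 8 * √N * ((B * M) ^ 2 / W) = 8 * √N * (B ^ 2 * (M ^ 2 / W)) := by ring
    _ ≤ 8 * n * (B ^ 2 * (κ ^ 2 / (q * P ^ 2) / n ^ 2)) := by gcongr
    _ = _ := by field_simp

end RandomGraph

theorem theorem3p2 {V : Type*} [Fintype V] (F : SimpleGraph V) (hF : F ≠ ⊥)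
    (p : unitInterval) (hp0 : 0 < p) (hp1 : p < 1) :
    ∃ C : ℝ, 0 < C ∧ ∀ n : ℕ, Fintype.card V ≤ n →
      0 < variance (injCount F) (SimpleGraph.binomialRandom (Fin n) p) ∧
      ∀ z : ℝ,
        |(SimpleGraph.binomialRandom (Fin n) p).real
            {G | (injCount F G - ∫ G', injCount F G' ∂(SimpleGraph.binomialRandom (Fin n) p)) /
              √(variance (injCount F) (SimpleGraph.binomialRandom (Fin n) p)) ≤ z} -
          cdf (gaussianReal 0 1) z| ≤ C / n := by
  classical
  have hp0' : (0 : ℝ) < p := hp0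
  have hp1' : (p : ℝ) < 1 := hp1
  have hq : 0 < (p : ℝ) * (1 - p) := mul_pos hp0' (sub_pos.2 hp1')
  set k := Fintype.card V with hk
  have hk2 : 2 ≤ k := by
    obtain ⟨a, b, hab⟩ := SimpleGraph.ne_bot_iff_exists_adj.1 hF
    exact Fintype.one_lt_card_iff.2 ⟨a, b, hab.ne⟩
  set m := k.choose 2 with hm
  have hm1 : 1 ≤ m := Nat.choose_pos hk2
  -- The constant of `berryEsseen_bound_le` with B = 4 · 2^m · m, κ = 2k², P = p^m. The number of
  -- copies of F on k labelled vertices enters both M and L and is absorbed in the inequality n² M ≤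
  -- κ L.
  refine ⟨8 * (4 * 2 ^ m * m) ^ 2 * (2 * k ^ 2) ^ 2 / (p * (1 - p) * (p ^ m) ^ 2), by positivity,
    fun n hn => ?_⟩
  have hn2 : 2 ≤ n := hk2.trans hn
  set U := (⊤ : SimpleGraph (Fin n)).edgeFinset with hU
  set T := subsetCount (copyIndex F n) copyEdges with hT
  have hIcard : (0 : ℝ) < (copyIndex F n).card := by
    rw [card_copyIndex]
    exact_mod_cast Nat.mul_pos (Nat.choose_pos hn) (copiesOn_nonempty F).card_pos
  have hsub : ∀ i ∈ copyIndex F n, copyEdges i ⊆ U := fun i _ => copyEdges_subset i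
  have hcard : ∀ i ∈ copyIndex F n, (copyEdges i).card ≤ m := fun i _ => copyEdges_card_le i
  have hUcard : (U.card : ℝ) ≤ (n : ℝ) ^ 2 := by
    rw [hU, SimpleGraph.card_edgeFinset_top_eq_card_choose_two, Fintype.card_fin]
    exact_mod_cast Nat.choose_le_pow n 2
  have hmean : ∫ G, injCount F G ∂(SimpleGraph.binomialRandom (Fin n) p) = bernoulliExp p U T :=
    integral_binomialRandom p fun G => injCount_eq_subsetCount F G
  have hvar : variance (injCount F) (SimpleGraph.binomialRandom (Fin n) p) =
      bernoulliVar p U T := by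
    rw [variance_eq_integral Measurable.of_discrete.aemeasurable, hmean]
    exact integral_binomialRandom p fun G => by rw [injCount_eq_subsetCount]
  have hlow := le_card_mul_bernoulliVar_subsetCount (U := U) hp0' hp1' hsub
    (fun i hi => copyEdges_nonempty hF hi) hcard
  have hVpos : 0 < bernoulliVar p U T := by
    refine pos_of_mul_pos_right (lt_of_lt_of_le ?_ hlow) (Nat.cast_nonneg _)
    positivity
  rw [hvar, hmean]
  refine ⟨hVpos, fun z => ?_⟩
  have hprob : (SimpleGraph.binomialRandom (Fin n) p).real
      {G | (injCount F G - bernoulliExp p U T) / √(bernoulliVar p U T) ≤ z} =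
      bernoulliExp p U (fun S =>
        if (T S - bernoulliExp p U T) / √(bernoulliVar p U T) ≤ z then 1 else 0) := by
    rw [← integral_indicator_one (Set.toFinite _).measurableSet]
    exact integral_binomialRandom p fun G => by
      simp [Set.indicator_apply, injCount_eq_subsetCount, hT]
  rw [hprob]
  have hM : ∀ e ∈ U, (((copyIndex F n).filter (e ∈ copyEdges ·)).card : ℝ) ≤
      ((n - 2).choose (k - 2) * (copiesOn F).card : ℕ) := fun e he => by
    refine Nat.cast_le.2 (card_copyIndex_through_le F ?_)
    simpa [hU] using he
  refine (subsetCount_berryEsseen hp0'.le hp1'.le hsub hm1 hcard hM hVpos z).trans ?_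
  refine berryEsseen_bound_le hq (pow_pos hp0' m) hIcard (by exact_mod_cast (by omega : 0 < n))
    (Nat.cast_nonneg _) hUcard ?_ hlow hVpos
  rw [card_copyIndex]
  have h := Nat.mul_le_mul_right (copiesOn F).card (sq_mul_choose_sub_two_le hk2 hn2)
  have h' : ((n ^ 2 * (n - 2).choose (k - 2) * (copiesOn F).card : ℕ) : ℝ) ≤
      (2 * k ^ 2 * n.choose k * (copiesOn F).card : ℕ) := Nat.cast_le.2 h
  push_cast at h' ⊢
  linarith
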